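/- **Setting.** Fix $a,b,c\in\{0,1\}$. Consider finite and infinite $\lambda$-trees built from variables, abstractions $\lambda x.s$ and applications $st$, up to $\alpha$-equivalence. The premiss "body of an abstraction" (resp. "function of an application", "argument of an application") is called *coinductive* if $a=1$ (resp. $b=1$, $c=1$) and *inductive* otherwise. In every set of rules below, derivations may be non-wellfounded provided that each infinite branch crosses infinitely many coinductive premisses (that is, the rules define $\nu X_1.\mu X_0.F(X_0,X_1)$, where the inductive premisses are taken in $X_0$ and the coinductive ones in $X_1$). The set $\Lambda^{abc}$ of *$abc$-infinitary $\lambda$-terms* is defined in this way by the rules: $x\in\Lambda^{abc}$; if $s\in\Lambda^{abc}$ then $\lambda x.s\in\Lambda^{abc}$; if $s,t\in\Lambda^{abc}$ then $st\in\Lambda^{abc}$. Truncation is given by $\lfloor s\rfloor_0=\ast$, $\lfloor x\rfloor_{d+1}=x$, $\lfloor\lambda x.s\rfloor_{d+1}=\lambda x.\lfloor s\rfloor_{d+1-a}$, $\lfloor st\rfloor_{d+1}=\lfloor s\rfloor_{d+1-b}\lfloor t\rfloor_{d+1-c}$, and the metric on $\Lambda^{abc}$ is $\mathrm{dist}(s,t)=\inf\{2^{-d}\mid\lfloor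 s\rfloor_d=\lfloor t\rfloor_d\}$. *$\beta$-reduction* with depths is generated inductively by $(\lambda x.s)t\to_0 s[t/x]$ and by: $u\to_d u'$ implies $\lambda x.u\to_{d+a}\lambda x.u'$, $uv\to_{d+b}u'v$ and $vu\to_{d+c}vu'$. We write $\to$ for $\bigcup_d\to_d$ and $\to^*$ for its reflexive-transitive closure. We write $s\to^\infty t$ if, for some ordinal $\gamma$, there are terms $(s_\delta)_{\delta\le\gamma}$ with $s_0=s$, $s_\gamma=t$ and steps $s_\delta\to_{d_\delta}s_{\delta+1}$ ($\delta<\gamma$) such that $\lim_{\delta\to\gamma'}s_\delta=s_{\gamma'}$ and $\lim_{\delta\to\gamma'}d_\delta=\infty$ for every limit ordinal $\gamma'\le\gamma$ (a strongly converging sequence). For each ordinal $\gamma$, relations $\to^\infty_\gamma$ and $\rightsquigarrow_\gamma$ on $\Lambda^{abc}$ are defined, by recursion on $\gamma$, by the following rules, whose premisses $u\to^\infty_\gamma u'$, $v\to^\infty_\gamma v'$ are inductive or coinductive as prescribed by $a,b,c$: - $x\rightsquigarrow_\gamma x$; if $u\to^\infty_\gamma u'$ then $\lambda x.u\rightsquigarrow_\gamma\lambda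 x.u'$; if $u\to^\infty_\gamma u'$ and $v\to^\infty_\gamma v'$ then $uv\rightsquigarrow_\gamma u'v'$; - if $s\Rightarrow_{\gamma,m}s'$ for some $m\in\mathbb N$ and $s'\rightsquigarrow_\gamma t$ then $s\to^\infty_\gamma t$, where $s\Rightarrow_{\gamma,m}s'$ means that there is a sequence $s\to^*s_1\rightsquigarrow_{\delta_1}t_1\to^*s_2\rightsquigarrow_{\delta_2}\cdots\rightsquigarrow_{\delta_m}t_m\to^*s'$ with all $\delta_i<\gamma$. Put $\to^\omega\;:=\;\to^\infty_0$. The *Compression property* is the equality $\to^\infty\;=\;\to^\omega$. Define the properties - $\mathrm P_\delta$: for all $n\in\mathbb N$ and all terms $s,s'$ with $s\Rightarrow_{\delta,n}s'$, there is a term $s''$ such that $s\to^*s''$ and either $s''=s'$ or $s''\rightsquigarrow_\varepsilon^*s'$ for some $\varepsilon<\delta$ (the first alternative matters only for $\delta=0$); - $\mathrm Q$: for all ordinals $\delta$ and terms $s,t,t'$, if $\mathrm P_\delta$ holds and $s\to^\infty_\delta t\to t'$, then there is a term $s'$ such that $s\to^*s'\to^\infty_\delta t'$. Finally, let $\to^{\mathrm{std}}$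 be the relation of the standard coinductive presentation, defined by the rules: if $s\to^*x$ then $s\to^{\mathrm{std}}x$; if $s\to^*\lambda x.u$ and $u\to^{\mathrm{std}}u'$ then $s\to^{\mathrm{std}}\lambda x.u'$; if $s\to^*uv$, $u\to^{\mathrm{std}}u'$ and $v\to^{\mathrm{std}}v'$ then $s\to^{\mathrm{std}}u'v'$; here the premisses on $u$ (body), $u$ (function) and $v$ (argument) are inductive or coinductive as prescribed by $a,b,c$. **Theorem.** For every choice of $a,b,c\in\{0,1\}$: 1. $\beta$-reduction on $\Lambda^{abc}$ satisfies the property $\mathrm Q$; 2. $\beta$-reduction on $\Lambda^{abc}$ has the Compression property: $s\to^\infty t$ if and only if $s\to^\omega t$; 3. for all $s,t\in\Lambda^{abc}$, $s\to^{\mathrm{std}}t$ if and only if $s\to^\infty_\gamma t$ for some $\gamma<\omega_1$, and also if and only if $s\to^\infty t$. -/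

import Mathlib

namespace InfLam

/-! ### Raw (possibly infinite) nameless trees -/

/-- Node labels: de Bruijn variables, abstraction, application, and the extra nullary symbol `∗`
that is only used to mark the places where a term has been truncated. -/
inductive Label : Type
  | star : Label
  | var : ℕ → Label
  | lam : Label
  | app : Label

/-- The number of children of a node. -/
def Label.arity : Label → ℕ
  | .star => 0
  | .var _ => 0
  | .lam => 1
  | .app => 2

/-- The signature of (nameless) λ-trees. -/
def sig : PFunctor.{0, 0} := ⟨Label, fun l => Fin l.arity⟩

/-- All finite and infinite trees over the signature. -/
abbrev Raw : Type := sig.M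

/-- One layer of a tree whose immediate subtrees are taken in `X`. -/
inductive Node (X : Type) : Type
  | star : Node X
  | var : ℕ → Node X
  | lam : X → Node X
  | app : X → X → Node X

namespace Node

def map {X Y : Type} (f : X → Y) : Node X → Node Y
  | star => star
  | var n => var n
  | lam x => lam (f x)
  | app x y => app (f x) (f y)

def toObj {X : Type} : Node X → sig X
  | star => ⟨Label.star, Fin.elim0⟩
  | var n => ⟨Label.var n, Fin.elim0⟩
  | lam x => ⟨Label.lam, fun _ => x⟩
  | app x y => ⟨Label.app, Fin.cons x (Fin.cons y Fin.elim0)⟩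

def ofObj {X : Type} : sig X → Node X
  | ⟨Label.star, _⟩ => star
  | ⟨Label.var n, _⟩ => var n
  | ⟨Label.lam, f⟩ => lam (f (0 : Fin 1))
  | ⟨Label.app, f⟩ => app (f (0 : Fin 2)) (f (1 : Fin 2))

theorem ofObj_toObj {X : Type} (n : Node X) : ofObj n.toObj = n := by
  cases n <;> rfl

theorem toObj_ofObj {X : Type} (o : sig X) : (ofObj o).toObj = o := by
  obtain ⟨l, f⟩ := o
  cases l with
  | star => exact congrArg (Sigma.mk Label.star) (funext fun i => Fin.elim0 i)
  | var n => exact congrArg (Sigma.mk (Label.var n)) (funext fun i => Fin.elim0 i)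
  | lam =>
    refine congrArg (Sigma.mk Label.lam) (funext fun (i : Fin 1) => ?_)
    fin_cases i; rfl
  | app =>
    refine congrArg (Sigma.mk Label.app) (funext fun (i : Fin 2) => ?_)
    fin_cases i <;> rfl

theorem ofObj_map {X Y : Type} (f : X → Y) (o : sig X) :
    ofObj (sig.map f o) = (ofObj o).map f := by
  obtain ⟨l, g⟩ := o
  cases l <;> rfl

end Node

namespace Raw

/-- The tree with a given root layer. -/
def mk (n : Node Raw) : Raw := PFunctor.M.mk (F := sig) n.toObj

/-- The root layer of a tree. -/
def dest (t : Raw) : Node Raw := Node.ofObj (PFunctor.M.dest (F := sig) t)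

/-- Corecursion: unfold a tree from a state space `X`. -/
def unfold {X : Type} (f : X → Node X) (x : X) : Raw :=
  PFunctor.M.corec (F := sig) (fun y => (f y).toObj) x

theorem dest_mk (n : Node Raw) : (mk n).dest = n := by
  unfold dest mk
  rw [PFunctor.M.dest_mk, Node.ofObj_toObj]

theorem mk_dest (t : Raw) : mk t.dest = t := by
  unfold dest mk
  rw [Node.toObj_ofObj, PFunctor.M.mk_dest]

theorem dest_unfold {X : Type} (f : X → Node X) (x : X) :
    (unfold f x).dest = (f x).map (unfold f) := by
  unfold dest unfold
  rw [PFunctor.M.dest_corec, Node.ofObj_map, Node.ofObj_toObj]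

theorem unfold_eq {X : Type} (f : X → Node X) (x : X) :
    unfold f x = mk ((f x).map (unfold f)) := by
  rw [← dest_unfold, mk_dest]

def var (n : ℕ) : Raw := mk (Node.var n)
def lam (s : Raw) : Raw := mk (Node.lam s)
def app (s t : Raw) : Raw := mk (Node.app s t)

/-- Extension of a renaming below a binder. -/
def liftRen (ρ : ℕ → ℕ) : ℕ → ℕ
  | 0 => 0
  | n + 1 => ρ n + 1

def renameStep : (ℕ → ℕ) × Raw → Node ((ℕ → ℕ) × Raw)
  | (ρ, t) =>
    match t.dest with
    | .star => .star
    | .var n => .var (ρ n)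
    | .lam u => .lam (liftRen ρ, u)
    | .app u v => .app (ρ, u) (ρ, v)

/-- Renaming of the free variables. -/
def rename (ρ : ℕ → ℕ) (t : Raw) : Raw := unfold renameStep (ρ, t)

/-- Extension of a substitution below a binder. -/
def up (σ : ℕ → Raw) : ℕ → Raw
  | 0 => var 0
  | n + 1 => rename Nat.succ (σ n)

/-- States: `inr (σ, t)` means that `σ` is still to be applied to `t`; `inl t` means that `t` is
copied unchanged. -/
def substStep : Raw ⊕ ((ℕ → Raw) × Raw) → Node (Raw ⊕ ((ℕ → Raw) × Raw))
  | .inl t => t.dest.map Sum.inl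
  | .inr (σ, t) =>
    match t.dest with
    | .star => .star
    | .var n => (σ n).dest.map Sum.inl
    | .lam u => .lam (.inr (up σ, u))
    | .app u v => .app (.inr (σ, u)) (.inr (σ, v))

/-- Simultaneous capture-avoiding substitution. -/
def subst (σ : ℕ → Raw) (t : Raw) : Raw := unfold substStep (.inr (σ, t))

/-- The substitution sending the variable `0` to `v` and lowering all the other variables. -/
def instSub (v : Raw) : ℕ → Raw
  | 0 => v
  | n + 1 => var n

def truncStep (a b c : Bool) : ℕ × Raw → Node (ℕ × Raw)
  | (0, _) => .star
  | (d + 1, t) =>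
    match t.dest with
    | .star => .star
    | .var n => .var n
    | .lam u => .lam (d + 1 - a.toNat, u)
    | .app u v => .app (d + 1 - b.toNat, u) (d + 1 - c.toNat, v)

/-- The `abc`-truncation at depth `d`. -/
def trunc (a b c : Bool) (d : ℕ) (t : Raw) : Raw := unfold (truncStep a b c) (d, t)

end Raw

/-! ### Mixed inductive-coinductive definitions -/

/-- `ν X₁. μ X₀. F X₀ X₁`. -/
def nuMu {α : Type*} [CompleteLattice α] (F : α → α → α)
    (hF : ∀ x x' y y', x ≤ x' → y ≤ y' → F x y ≤ F x' y') : α :=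
  OrderHom.gfp
    { toFun := fun X₁ => OrderHom.lfp
        { toFun := fun X₀ => F X₀ X₁
          monotone' := fun _ _ h => hF _ _ _ _ h le_rfl }
      monotone' := fun _ _ h => OrderHom.lfp.monotone fun _ => hF _ _ _ _ le_rfl h }

/-- A premiss guarded by `later e` is inductive if `e = 0` and coinductive if `e = 1`. -/
def later {α : Type*} (e : Bool) (X₀ X₁ : α) : α := if e then X₁ else X₀

theorem later_mono {α : Type*} [Preorder α] (e : Bool) {x x' y y' : α} (hx : x ≤ x')
    (hy : y ≤ y') : later e x y ≤ later e x' y' := by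
  cases e
  · exact hx
  · exact hy

theorem nuMu_fold {α : Type*} [CompleteLattice α] (F : α → α → α)
    (hF : ∀ x x' y y', x ≤ x' → y ≤ y' → F x y ≤ F x' y') :
    F (nuMu F hF) (nuMu F hF) = nuMu F hF := by
  have h1 : OrderHom.lfp { toFun := fun X₀ => F X₀ (nuMu F hF)
                           monotone' := fun _ _ h => hF _ _ _ _ h le_rfl } = nuMu F hF :=
    OrderHom.map_gfp (α := α)
      { toFun := fun X₁ => OrderHom.lfp
          { toFun := fun X₀ => F X₀ X₁
            monotone' := fun _ _ h => hF _ _ _ _ h le_rfl }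
        monotone' := fun _ _ h => OrderHom.lfp.monotone fun _ => hF _ _ _ _ le_rfl h }
  have h2 := OrderHom.map_lfp (α := α)
    { toFun := fun X₀ => F X₀ (nuMu F hF)
      monotone' := fun _ _ h => hF _ _ _ _ h le_rfl }
  rw [h1] at h2
  exact h2

/-- Coinduction for `nuMu`: it suffices to find `C` such that every pre-fixed point of `F · C`
lies above `C`. -/
theorem le_nuMu {α : Type*} [CompleteLattice α] (F : α → α → α)
    (hF : ∀ x x' y y', x ≤ x' → y ≤ y' → F x y ≤ F x' y') (C : α)
    (h : ∀ I, F I C ≤ I → C ≤ I) : C ≤ nuMu F hF :=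
  OrderHom.le_gfp _ (OrderHom.le_lfp _ h)

/-- Induction for `nuMu`. -/
theorem nuMu_le {α : Type*} [CompleteLattice α] (F : α → α → α)
    (hF : ∀ x x' y y', x ≤ x' → y ≤ y' → F x y ≤ F x' y') (I : α)
    (h : F I (nuMu F hF) ≤ I) : nuMu F hF ≤ I := by
  have h1 : OrderHom.lfp { toFun := fun X₀ => F X₀ (nuMu F hF)
                           monotone' := fun _ _ h => hF _ _ _ _ h le_rfl } = nuMu F hF :=
    OrderHom.map_gfp (α := α)
      { toFun := fun X₁ => OrderHom.lfp
          { toFun := fun X₀ => F X₀ X₁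
            monotone' := fun _ _ h => hF _ _ _ _ h le_rfl }
        monotone' := fun _ _ h => OrderHom.lfp.monotone fun _ => hF _ _ _ _ le_rfl h }
  rw [← h1]
  exact OrderHom.lfp_le _ h

/-! ### The `abc`-infinitary λ-terms -/

/-- The formation rules of `abc`-infinitary λ-terms. -/
inductive TermRule (a b c : Bool) (X₀ X₁ : Set Raw) : Raw → Prop
  | var (n : ℕ) : TermRule a b c X₀ X₁ (Raw.var n)
  | lam {s : Raw} : s ∈ later a X₀ X₁ → TermRule a b c X₀ X₁ (Raw.lam s)
  | app {s t : Raw} : s ∈ later b X₀ X₁ → t ∈ later c X₀ X₁ →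
      TermRule a b c X₀ X₁ (Raw.app s t)

theorem termRule_mono (a b c : Bool) (x x' y y' : Set Raw) (hx : x ≤ x') (hy : y ≤ y') :
    {t | TermRule a b c x y t} ≤ {t | TermRule a b c x' y' t} := by
  rintro t (n | h | ⟨h, h'⟩)
  · exact .var n
  · exact .lam (later_mono a hx hy h)
  · exact .app (later_mono b hx hy h) (later_mono c hx hy h')

/-- The trees derivable by the formation rules, with inductive and coinductive premisses as
prescribed by `a`, `b`, `c`. -/
def termSet (a b c : Bool) : Set Raw :=
  nuMu (fun X₀ X₁ => {t | TermRule a b c X₀ X₁ t}) (termRule_mono a b c)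

/-- The set `Λ^{abc}` of `abc`-infinitary λ-terms (up to α-equivalence). -/
def Term (a b c : Bool) : Type := {t : Raw // t ∈ termSet a b c}

theorem termSet_fold (a b c : Bool) :
    {t | TermRule a b c (termSet a b c) (termSet a b c) t} = termSet a b c :=
  nuMu_fold _ (termRule_mono a b c)

theorem later_self {α : Type*} (e : Bool) (x : α) : later e x x = x := by
  cases e <;> rfl

theorem var_mem (a b c : Bool) (n : ℕ) : Raw.var n ∈ termSet a b c := by
  rw [← termSet_fold]
  exact TermRule.var n

theorem lam_mem {a b c : Bool} {s : Raw} (hs : s ∈ termSet a b c) :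
    Raw.lam s ∈ termSet a b c := by
  rw [← termSet_fold]
  exact TermRule.lam (by rwa [later_self])

theorem app_mem {a b c : Bool} {s t : Raw} (hs : s ∈ termSet a b c) (ht : t ∈ termSet a b c) :
    Raw.app s t ∈ termSet a b c := by
  rw [← termSet_fold]
  exact TermRule.app (by rwa [later_self]) (by rwa [later_self])

theorem rename_var (ρ : ℕ → ℕ) (n : ℕ) : (Raw.var n).rename ρ = Raw.var (ρ n) := by
  unfold Raw.rename
  rw [Raw.unfold_eq]
  simp only [Raw.renameStep, Raw.var, Raw.dest_mk, Node.map]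

theorem rename_lam (ρ : ℕ → ℕ) (s : Raw) :
    (Raw.lam s).rename ρ = Raw.lam (s.rename (Raw.liftRen ρ)) := by
  conv_lhs => unfold Raw.rename
  rw [Raw.unfold_eq]
  simp only [Raw.renameStep, Raw.lam, Raw.dest_mk, Node.map, Raw.rename]

theorem rename_app (ρ : ℕ → ℕ) (s t : Raw) :
    (Raw.app s t).rename ρ = Raw.app (s.rename ρ) (t.rename ρ) := by
  conv_lhs => unfold Raw.rename
  rw [Raw.unfold_eq]
  simp only [Raw.renameStep, Raw.app, Raw.dest_mk, Node.map, Raw.rename]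

/-- Copying a tree through the left states of `substStep` gives the same tree. -/
theorem unfold_substStep_inl (t : Raw) : Raw.unfold Raw.substStep (.inl t) = t := by
  have h := PFunctor.M.corec_unique (P := sig) (fun t : Raw => t.dest.toObj)
  have h1 : (fun t : Raw => Raw.unfold Raw.substStep (.inl t)) =
      PFunctor.M.corec (F := sig) (fun t : Raw => t.dest.toObj) := by
    refine h _ fun x => ?_
    have := Raw.dest_unfold Raw.substStep (.inl x)
    have h2 := congrArg Node.toObj this
    unfold Raw.dest at h2
    rw [Node.toObj_ofObj] at h2
    rw [h2]
    simp only [Raw.substStep]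
    cases x.dest with
    | star => exact congrArg (Sigma.mk Label.star) (funext fun i => Fin.elim0 i)
    | var n => exact congrArg (Sigma.mk (Label.var n)) (funext fun i => Fin.elim0 i)
    | lam u => rfl
    | app u v =>
      refine congrArg (Sigma.mk Label.app) (funext fun (i : Fin 2) => ?_)
      fin_cases i <;> rfl
  have h3 : (fun t : Raw => t) =
      PFunctor.M.corec (F := sig) (fun t : Raw => t.dest.toObj) := by
    refine h _ fun x => ?_
    simp only [Raw.dest, Node.toObj_ofObj]
    exact (PFunctor.id_map sig _).symm
  exact congrFun (h1.trans h3.symm) t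

theorem subst_var (σ : ℕ → Raw) (n : ℕ) : (Raw.var n).subst σ = σ n := by
  unfold Raw.subst
  rw [Raw.unfold_eq]
  simp only [Raw.substStep, Raw.var, Raw.dest_mk]
  rw [← unfold_substStep_inl (σ n), Raw.unfold_eq]
  simp only [Raw.substStep]
  congr 1
  cases h : (σ n).dest <;> simp [Raw.dest_mk, Node.map, unfold_substStep_inl]

theorem subst_lam (σ : ℕ → Raw) (s : Raw) :
    (Raw.lam s).subst σ = Raw.lam (s.subst (Raw.up σ)) := by
  conv_lhs => unfold Raw.subst
  rw [Raw.unfold_eq]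
  simp only [Raw.substStep, Raw.lam, Raw.dest_mk, Node.map, Raw.subst]

theorem subst_app (σ : ℕ → Raw) (s t : Raw) :
    (Raw.app s t).subst σ = Raw.app (s.subst σ) (t.subst σ) := by
  conv_lhs => unfold Raw.subst
  rw [Raw.unfold_eq]
  simp only [Raw.substStep, Raw.app, Raw.dest_mk, Node.map, Raw.subst]

theorem rename_mem {a b c : Bool} {t : Raw} (ht : t ∈ termSet a b c) (ρ : ℕ → ℕ) :
    t.rename ρ ∈ termSet a b c := by
  let C : Set Raw := {r | ∃ s ∈ termSet a b c, ∃ ρ, r = s.rename ρ}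
  suffices h : C ≤ termSet a b c from h ⟨t, ht, ρ, rfl⟩
  refine le_nuMu _ _ C fun I hI => ?_
  have key : termSet a b c ≤ {s | ∀ ρ, s.rename ρ ∈ I} := by
    refine nuMu_le _ _ _ ?_
    have hl : ∀ (e : Bool) (s : Raw), s ∈ later e {s : Raw | ∀ ρ, s.rename ρ ∈ I}
        (termSet a b c) → ∀ ρ, s.rename ρ ∈ later e I C := by
      intro e s hs ρ
      cases e
      · exact hs ρ
      · exact ⟨s, hs, ρ, rfl⟩
    rintro s (n | h | ⟨h, h'⟩) ρ
    · rw [rename_var]; exact hI (.var _)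
    · rw [rename_lam]; exact hI (.lam (hl _ _ h _))
    · rw [rename_app]; exact hI (.app (hl _ _ h _) (hl _ _ h' _))
  rintro r ⟨s, hs, ρ, rfl⟩
  exact key hs ρ

theorem subst_mem {a b c : Bool} {t : Raw} (ht : t ∈ termSet a b c) (σ : ℕ → Raw)
    (hσ : ∀ n, σ n ∈ termSet a b c) : t.subst σ ∈ termSet a b c := by
  have hup : ∀ σ : ℕ → Raw, (∀ n, σ n ∈ termSet a b c) → ∀ n, Raw.up σ n ∈ termSet a b c := by
    intro σ hσ n
    cases n with
    | zero => exact var_mem a b c 0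
    | succ n => exact rename_mem (hσ n) _
  let C : Set Raw := termSet a b c ∪
    {r | ∃ s ∈ termSet a b c, ∃ σ : ℕ → Raw, (∀ n, σ n ∈ termSet a b c) ∧ r = s.subst σ}
  suffices h : C ≤ termSet a b c from h (Or.inr ⟨t, ht, σ, hσ, rfl⟩)
  refine le_nuMu _ _ C fun I hI => ?_
  have key0 : termSet a b c ≤ I := by
    refine nuMu_le _ _ _ (le_trans ?_ hI)
    exact termRule_mono a b c _ _ _ _ le_rfl fun x hx => Or.inl hx
  have key : termSet a b c ≤
      {s | ∀ σ : ℕ → Raw, (∀ n, σ n ∈ termSet a b c) → s.subst σ ∈ I} := by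
    refine nuMu_le _ _ _ ?_
    have hl : ∀ (e : Bool) (s : Raw), s ∈ later e
        {s : Raw | ∀ σ : ℕ → Raw, (∀ n, σ n ∈ termSet a b c) → s.subst σ ∈ I}
        (termSet a b c) → ∀ σ : ℕ → Raw, (∀ n, σ n ∈ termSet a b c) →
          s.subst σ ∈ later e I C := by
      intro e s hs σ hσ
      cases e
      · exact hs σ hσ
      · exact Or.inr ⟨s, hs, σ, hσ, rfl⟩
    rintro s (n | h | ⟨h, h'⟩) σ hσ
    · rw [subst_var]; exact key0 (hσ n)
    · rw [subst_lam]; exact hI (.lam (hl _ _ h _ (hup _ hσ)))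
    · rw [subst_app]; exact hI (.app (hl _ _ h _ hσ) (hl _ _ h' _ hσ))
  rintro r (hr | ⟨s, hs, σ, hσ, rfl⟩)
  · exact key0 hr
  · exact key hs σ hσ

theorem instSub_mem {a b c : Bool} {v : Raw} (hv : v ∈ termSet a b c) (n : ℕ) :
    Raw.instSub v n ∈ termSet a b c := by
  cases n with
  | zero => exact hv
  | succ n => exact var_mem a b c n

namespace Term

variable {a b c : Bool}

def var (n : ℕ) : Term a b c := ⟨Raw.var n, var_mem a b c n⟩
def lam (s : Term a b c) : Term a b c := ⟨Raw.lam s.1, lam_mem s.2⟩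
def app (s t : Term a b c) : Term a b c := ⟨Raw.app s.1 t.1, app_mem s.2 t.2⟩

/-- `inst u v` is `u[v/x]` where `x` is the variable bound by the outer abstraction in `λx.u`. -/
def inst (u v : Term a b c) : Term a b c :=
  ⟨u.1.subst (Raw.instSub v.1), subst_mem u.2 _ (instSub_mem v.2)⟩

/-- The metric `d(s,t) = inf {2⁻ᵈ | s and t have the same abc-truncation at depth d}`. -/
noncomputable def dist (s t : Term a b c) : ℝ :=
  sInf {x : ℝ | ∃ d : ℕ, x = (1 / 2) ^ d ∧ s.1.trunc a b c d = t.1.trunc a b c d}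

end Term

/-! ### β-reduction and strongly converging reduction sequences -/

/-- `BetaAt d s t`: a β-reduction step from `s` to `t` at depth `d`. -/
inductive BetaAt {a b c : Bool} : ℕ → Term a b c → Term a b c → Prop
  | beta (u v : Term a b c) : BetaAt 0 (Term.app (Term.lam u) v) (Term.inst u v)
  | lam {d : ℕ} {u u' : Term a b c} : BetaAt d u u' →
      BetaAt (d + a.toNat) (Term.lam u) (Term.lam u')
  | appL {d : ℕ} {u u' v : Term a b c} : BetaAt d u u' →
      BetaAt (d + b.toNat) (Term.app u v) (Term.app u' v)
  | appR {d : ℕ} {u v v' : Term a b c} : BetaAt d v v' →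
      BetaAt (d + c.toNat) (Term.app u v) (Term.app u v')

/-- β-reduction. -/
def Beta {a b c : Bool} (s t : Term a b c) : Prop := ∃ d, BetaAt d s t

/-- Finite β-reduction sequences. -/
def BetaStar {a b c : Bool} : Term a b c → Term a b c → Prop := Relation.ReflTransGen Beta

/-- A strongly converging β-reduction sequence of length `γ`, given by its terms `s δ` (`δ ≤ γ`)
and the depths `d δ` (`δ < γ`) of its steps. -/
structure IsStronglyConverging {a b c : Bool} (γ : Ordinal.{0}) (s : Ordinal.{0} → Term a b c)
    (d : Ordinal.{0} → ℕ) : Prop where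
  step : ∀ δ < γ, BetaAt (d δ) (s δ) (s (δ + 1))
  tendsto_term : ∀ γ' ≤ γ, Order.IsSuccLimit γ' →
    ∀ ε > 0, ∃ δ₀ < γ', ∀ δ, δ₀ ≤ δ → δ < γ' → Term.dist (s δ) (s γ') < ε
  tendsto_depth : ∀ γ' ≤ γ, Order.IsSuccLimit γ' →
    ∀ N : ℕ, ∃ δ₀ < γ', ∀ δ, δ₀ ≤ δ → δ < γ' → N ≤ d δ

/-- Infinitary β-reduction `s ⟶^∞ t`: there is a strongly converging β-reduction sequence, of some
ordinal length, from `s` to `t`. -/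
def RedInf {a b c : Bool} (s t : Term a b c) : Prop :=
  ∃ (γ : Ordinal.{0}) (r : Ordinal.{0} → Term a b c) (d : Ordinal.{0} → ℕ),
    IsStronglyConverging γ r d ∧ r 0 = s ∧ r γ = t

/-! ### The coinductive presentation with ordinal annotations -/

/-- The rules `lift`. -/
inductive Lift {a b c : Bool} (X₀ X₁ : Term a b c → Term a b c → Prop) :
    Term a b c → Term a b c → Prop
  | var (n : ℕ) : Lift X₀ X₁ (Term.var n) (Term.var n)
  | lam {u u' : Term a b c} : later a X₀ X₁ u u' → Lift X₀ X₁ (Term.lam u) (Term.lam u')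
  | app {u u' v v' : Term a b c} : later b X₀ X₁ u u' → later c X₀ X₁ v v' →
      Lift X₀ X₁ (Term.app u v) (Term.app u' v')

theorem lift_mono {a b c : Bool} (x x' y y' : Term a b c → Term a b c → Prop) (hx : x ≤ x')
    (hy : y ≤ y') : Lift x y ≤ Lift x' y' := by
  rintro s t (n | h | ⟨h, h'⟩)
  · exact .var n
  · exact .lam (later_mono a hx hy _ _ h)
  · exact .app (later_mono b hx hy _ _ h) (later_mono c hx hy _ _ h')

/-- `SeqOf G m s s'`: a sequence `s ⟶* s₁ G t₁ ⟶* s₂ G t₂ ⟶* … s_m G t_m ⟶* s'`. -/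
inductive SeqOf {a b c : Bool} (G : Term a b c → Term a b c → Prop) :
    ℕ → Term a b c → Term a b c → Prop
  | zero {s s' : Term a b c} : BetaStar s s' → SeqOf G 0 s s'
  | succ {m : ℕ} {s s₁ t₁ s' : Term a b c} : BetaStar s s₁ → G s₁ t₁ → SeqOf G m t₁ s' →
      SeqOf G (m + 1) s s'

/-- The rule `split`, followed by a rule `lift`. -/
def SplitLift {a b c : Bool} (G X₀ X₁ : Term a b c → Term a b c → Prop) (s t : Term a b c) :
    Prop :=
  ∃ m s', SeqOf G m s s' ∧ Lift X₀ X₁ s' t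

theorem splitLift_mono {a b c : Bool} (G x x' y y' : Term a b c → Term a b c → Prop) (hx : x ≤ x')
    (hy : y ≤ y') : SplitLift G x y ≤ SplitLift G x' y' :=
  fun _ _ ⟨m, s', h, h'⟩ => ⟨m, s', h, lift_mono _ _ _ _ hx hy _ _ h'⟩

/-- The relation defined by the rules `split` and `lift`, where `G` is the union of the auxiliary
relations allowed in the first premiss of `split`. -/
def RedOf {a b c : Bool} (G : Term a b c → Term a b c → Prop) :
    Term a b c → Term a b c → Prop :=
  nuMu (SplitLift G) (splitLift_mono G)

/-- The auxiliary relation `s ⇝_γ t`, whose derivations end with a rule `lift`. -/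
def RedIG {a b c : Bool} (γ : Ordinal.{0}) : Term a b c → Term a b c → Prop :=
  Lift (RedOf fun s t => ∃ δ, ∃ _ : δ < γ, RedIG δ s t)
    (RedOf fun s t => ∃ δ, ∃ _ : δ < γ, RedIG δ s t)
termination_by γ

/-- The union of the relations `⇝_δ` for `δ < γ`. -/
def RedIGBelow {a b c : Bool} (γ : Ordinal.{0}) (s t : Term a b c) : Prop :=
  ∃ δ < γ, RedIG δ s t

/-- The relation `s ⟶^∞_γ t`, whose derivations end with the rule `split`. -/
def RedI {a b c : Bool} (γ : Ordinal.{0}) : Term a b c → Term a b c → Prop :=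
  RedOf (RedIGBelow γ)

/-- The coinductive presentation of infinitary β-reduction: the union of the `⟶^∞_γ` over all the
countable ordinals `γ`. -/
def RedCoind {a b c : Bool} (s t : Term a b c) : Prop :=
  ∃ γ < Ordinal.omega.{0} 1, RedI γ s t

/-- Compressed infinitary β-reduction `s ⟶^ω t`. -/
def RedOmega {a b c : Bool} : Term a b c → Term a b c → Prop := RedI 0

/-! ### The properties -/

/-- The property `P_δ`. The first disjunct only matters for `δ = 0`, where `P_0` holds trivially. -/
def PropertyP (a b c : Bool) (δ : Ordinal.{0}) : Prop :=
  ∀ (n : ℕ) (s s' : Term a b c), SeqOf (RedIGBelow δ) n s s' →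
    ∃ s'' : Term a b c, BetaStar s s'' ∧
      (s'' = s' ∨ ∃ ε < δ, Relation.ReflTransGen (RedIG ε) s'' s')

/-- The property `Q`. -/
def PropertyQ (a b c : Bool) : Prop :=
  ∀ (δ : Ordinal.{0}) (s t t' : Term a b c), PropertyP a b c δ → RedI δ s t → Beta t t' →
    ∃ s' : Term a b c, BetaStar s s' ∧ RedI δ s' t'

/-- The Compression property: `⟶^∞` and `⟶^ω` are the same relation. -/
def HasCompression (a b c : Bool) : Prop :=
  ∀ s t : Term a b c, RedInf s t ↔ RedOmega s t

/-! ### The standard coinductive presentation -/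

/-- The rules of the standard coinductive presentation of infinitary β-reduction. -/
inductive StdRule {a b c : Bool} (X₀ X₁ : Term a b c → Term a b c → Prop) :
    Term a b c → Term a b c → Prop
  | var {s : Term a b c} {n : ℕ} : BetaStar s (Term.var n) → StdRule X₀ X₁ s (Term.var n)
  | lam {s u u' : Term a b c} : BetaStar s (Term.lam u) → later a X₀ X₁ u u' →
      StdRule X₀ X₁ s (Term.lam u')
  | app {s u u' v v' : Term a b c} : BetaStar s (Term.app u v) → later b X₀ X₁ u u' →
      later c X₀ X₁ v v' → StdRule X₀ X₁ s (Term.app u' v')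

theorem stdRule_mono {a b c : Bool} (x x' y y' : Term a b c → Term a b c → Prop) (hx : x ≤ x')
    (hy : y ≤ y') : StdRule x y ≤ StdRule x' y' := by
  rintro s t (h | ⟨h, h1⟩ | ⟨h, h1, h2⟩)
  · exact .var h
  · exact .lam h (later_mono a hx hy _ _ h1)
  · exact .app h (later_mono b hx hy _ _ h1) (later_mono c hx hy _ _ h2)

/-- Infinitary β-reduction in the standard coinductive presentation. -/
def RedStd {a b c : Bool} : Term a b c → Term a b c → Prop :=
  nuMu StdRule stdRule_mono

end InfLam

/-!
The standard relation `⟶^std` is reflexive, stable under substitution, and absorbs β-steps on the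
right: a contracted redex is the image of a redex of a term to which the source reduces finitely. It
is therefore transitive, since the finite reduction at the root of a second derivation can be
absorbed by the first one, after which the immediate subterms are handled coinductively. By
induction on `γ`, the first premiss of the rule `split` is then a composition of reductions
`⟶^std`, so that each relation `⟶^∞_γ` coincides with `⟶^std`.

Given a strongly converging sequence of limit length, some tail of it agrees with the limit at
depth `1` and only has steps at depth at least `1`. It splits into sequences between the immediate
subterms, which by transitivity start a derivation of `⟶^std`, the derivation being completed by
coinduction. Conversely, unfolding a derivation of `s ⟶^std t` one level at a time provides, for
every `n`, a finite reduction with steps at depth at least `n`; the concatenation of these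
reductions has length at most `ω` and converges strongly to `t`.
-/

namespace InfLam

/-! ### Mixed induction and coinduction -/

section NuMu

variable {α : Type*} [CompleteLattice α] {F F' : α → α → α}
  {hF : ∀ x x' y y', x ≤ x' → y ≤ y' → F x y ≤ F x' y'}
  {hF' : ∀ x x' y y', x ≤ x' → y ≤ y' → F' x y ≤ F' x' y'}

theorem nuMu_le_of_inf {I : α} (h : F (I ⊓ nuMu F hF) (nuMu F hF) ≤ I) : nuMu F hF ≤ I := by
  refine (nuMu_le F hF (I ⊓ nuMu F hF) (le_inf h ?_)).trans inf_le_left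
  exact (hF _ _ _ _ inf_le_right le_rfl).trans (nuMu_fold F hF).le

theorem le_nuMu_of_sup {C : α} (h : ∀ I, nuMu F hF ≤ I → F I (C ⊔ nuMu F hF) ≤ I → C ≤ I) :
    C ≤ nuMu F hF := by
  refine le_sup_left.trans (le_nuMu F hF (C ⊔ nuMu F hF) fun I hI => ?_)
  have hν : nuMu F hF ≤ I := nuMu_le F hF I ((hF _ _ _ _ le_rfl le_sup_right).trans hI)
  exact sup_le (h I hν hI) hν

theorem nuMu_mono (h : ∀ x y, F x y ≤ F' x y) : nuMu F hF ≤ nuMu F' hF' :=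
  le_nuMu F' hF' _ fun I hI => nuMu_le F hF I ((h _ _).trans hI)

end NuMu

theorem mem_later_inf {α : Type*} {e : Bool} {I X : Set α} {x : α} :
    x ∈ later e (I ⊓ X) X ↔ x ∈ X ∧ (e = false → x ∈ I) := by
  cases e <;> simp [later, and_comm]

theorem later_inf_apply_iff {α β : Type*} {e : Bool} {I X : α → β → Prop} {x : α} {y : β} :
    later e (I ⊓ X) X x y ↔ X x y ∧ (e = false → I x y) := by
  cases e <;> simp [later, and_comm]

theorem later_apply_iff {α β : Type*} {e : Bool} {X₀ X₁ : α → β → Prop} {x : α} {y : β} :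
    later e X₀ X₁ x y ↔ (e = false → X₀ x y) ∧ (e = true → X₁ x y) := by
  cases e <;> simp [later]

/-! ### Raw trees -/

namespace Raw

/-- The leaf `∗`, the truncation of every tree at depth `0`. -/
def star : Raw := mk Node.star

@[elab_as_elim]
theorem cases {P : Raw → Prop} (star : P star) (var : ∀ n, P (var n)) (lam : ∀ u, P (lam u))
    (app : ∀ u v, P (app u v)) (t : Raw) : P t := by
  rw [← mk_dest t]
  cases t.dest with
  | star => exact star
  | var n => exact var n
  | lam u => exact lam u
  | app u v => exact app u v

theorem mk_inj {m n : Node Raw} : mk m = mk n ↔ m = n :=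
  Function.LeftInverse.injective dest_mk |>.eq_iff

theorem var_inj {m n : ℕ} : var m = var n ↔ m = n := by
  simp only [var, mk_inj, Node.var.injEq]

theorem lam_inj {u v : Raw} : lam u = lam v ↔ u = v := by
  simp only [lam, mk_inj, Node.lam.injEq]

theorem app_inj {u v u' v' : Raw} : app u v = app u' v' ↔ u = u' ∧ v = v' := by
  simp only [app, mk_inj, Node.app.injEq]

theorem var_ne_lam {n : ℕ} {u : Raw} : var n ≠ lam u := mk_inj.not.2 nofun

theorem var_ne_app {n : ℕ} {u v : Raw} : var n ≠ app u v := mk_inj.not.2 nofun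

theorem lam_ne_app {w u v : Raw} : lam w ≠ app u v := mk_inj.not.2 nofun

/-- One step of a bisimulation: the trees are equal, or they have the same root and their
immediate subtrees are related by `R`. -/
inductive Layer (R : Raw → Raw → Prop) : Raw → Raw → Prop
  | refl (s : Raw) : Layer R s s
  | lam {u u' : Raw} : R u u' → Layer R (lam u) (lam u')
  | app {u u' v v' : Raw} : R u u' → R v v' → Layer R (app u v) (app u' v')

theorem eq_of_bisim (R : Raw → Raw → Prop) (h : ∀ s t, R s t → Layer R s t) {s t : Raw}
    (hst : R s t) : s = t := by
  refine PFunctor.M.bisim (fun x y => R x y ∨ x = y) ?_ s t (.inl hst)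
  rintro x y (hxy | rfl)
  · rcases h x y hxy with _ | hu | ⟨hu, hv⟩
    · exact ⟨_, _, _, rfl, rfl, fun _ => .inr rfl⟩
    · exact ⟨_, _, _, PFunctor.M.dest_mk _, PFunctor.M.dest_mk _, fun _ => .inl hu⟩
    · refine ⟨_, _, _, PFunctor.M.dest_mk _, PFunctor.M.dest_mk _, fun (i : Fin 2) => ?_⟩
      fin_cases i
      exacts [.inl hu, .inl hv]
  · exact ⟨_, _, _, rfl, rfl, fun _ => .inr rfl⟩

theorem rename_star (ρ : ℕ → ℕ) : star.rename ρ = star := by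
  rw [rename, unfold_eq]
  simp only [renameStep, star, dest_mk, Node.map]

theorem subst_star (σ : ℕ → Raw) : star.subst σ = star := by
  rw [subst, unfold_eq]
  simp only [substStep, star, dest_mk, Node.map]

theorem up_var_comp (ρ : ℕ → ℕ) : up (fun n => var (ρ n)) = fun n => var (liftRen ρ n) := by
  funext n
  cases n with
  | zero => rfl
  | succ n => exact rename_var _ _

theorem up_var : up var = var := by
  funext n
  cases n with
  | zero => rfl
  | succ n => exact rename_var _ _

theorem up_comp (σ : ℕ → Raw) (ρ : ℕ → ℕ) :
    up (fun n => σ (ρ n)) = fun n => up σ (liftRen ρ n) := by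
  funext n
  cases n <;> rfl

theorem rename_eq_subst (ρ : ℕ → ℕ) (t : Raw) : t.rename ρ = t.subst fun n => var (ρ n) := by
  refine eq_of_bisim (fun x y => ∃ ρ t, x = rename ρ t ∧ y = subst (fun n => var (ρ n)) t) ?_
    ⟨ρ, t, rfl, rfl⟩
  rintro _ _ ⟨ρ, t, rfl, rfl⟩
  cases t using Raw.cases with
  | star => rw [rename_star, subst_star]; exact .refl _
  | var n => rw [rename_var, subst_var]; exact .refl _
  | lam u => rw [rename_lam, subst_lam, up_var_comp]; exact .lam ⟨_, _, rfl, rfl⟩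
  | app u v => rw [rename_app, subst_app]; exact .app ⟨_, _, rfl, rfl⟩ ⟨_, _, rfl, rfl⟩

theorem subst_id (t : Raw) : t.subst var = t := by
  refine eq_of_bisim (fun x y => x = subst var y) ?_ rfl
  rintro _ t rfl
  cases t using Raw.cases with
  | star => rw [subst_star]; exact .refl _
  | var n => rw [subst_var]; exact .refl _
  | lam u => rw [subst_lam, up_var]; exact .lam rfl
  | app u v => rw [subst_app]; exact .app rfl rfl

theorem subst_rename (ρ : ℕ → ℕ) (σ : ℕ → Raw) (t : Raw) :
    (t.rename ρ).subst σ = t.subst fun n => σ (ρ n) := by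
  refine eq_of_bisim
    (fun x y => ∃ ρ σ t, x = subst σ (rename ρ t) ∧ y = subst (fun n => σ (ρ n)) t) ?_
    ⟨ρ, σ, t, rfl, rfl⟩
  rintro _ _ ⟨ρ, σ, t, rfl, rfl⟩
  cases t using Raw.cases with
  | star => rw [rename_star, subst_star, subst_star]; exact .refl _
  | var n => rw [rename_var, subst_var, subst_var]; exact .refl _
  | lam u => rw [rename_lam, subst_lam, subst_lam, up_comp σ ρ]; exact .lam ⟨_, _, _, rfl, rfl⟩
  | app u v =>
    rw [rename_app, subst_app, subst_app]
    exact .app ⟨_, _, _, rfl, rfl⟩ ⟨_, _, _, rfl, rfl⟩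

theorem rename_rename (ρ ρ' : ℕ → ℕ) (t : Raw) :
    (t.rename ρ).rename ρ' = t.rename fun n => ρ' (ρ n) := by
  rw [rename_eq_subst ρ', subst_rename, rename_eq_subst]

theorem up_rename (σ : ℕ → Raw) (ρ : ℕ → ℕ) :
    up (fun n => (σ n).rename ρ) = fun n => (up σ n).rename (liftRen ρ) := by
  funext n
  cases n with
  | zero => exact (rename_var (liftRen ρ) 0).symm
  | succ n => simp only [up, rename_rename, liftRen, Nat.succ_eq_add_one]

theorem rename_subst (σ : ℕ → Raw) (ρ : ℕ → ℕ) (t : Raw) :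
    (t.subst σ).rename ρ = t.subst fun n => (σ n).rename ρ := by
  refine eq_of_bisim
    (fun x y => ∃ ρ σ t, x = rename ρ (subst σ t) ∧ y = subst (fun n => (σ n).rename ρ) t) ?_
    ⟨ρ, σ, t, rfl, rfl⟩
  rintro _ _ ⟨ρ, σ, t, rfl, rfl⟩
  cases t using Raw.cases with
  | star => rw [subst_star, rename_star, subst_star]; exact .refl _
  | var n => rw [subst_var, subst_var]; exact .refl _
  | lam u => rw [subst_lam, subst_lam, rename_lam, up_rename]; exact .lam ⟨_, _, _, rfl, rfl⟩
  | app u v =>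
    rw [subst_app, rename_app, subst_app]
    exact .app ⟨_, _, _, rfl, rfl⟩ ⟨_, _, _, rfl, rfl⟩

theorem up_subst (σ τ : ℕ → Raw) :
    up (fun n => (σ n).subst τ) = fun n => (up σ n).subst (up τ) := by
  funext n
  cases n with
  | zero => exact (subst_var (up τ) 0).symm
  | succ n => simp only [up, subst_rename, rename_subst]

theorem subst_subst (σ τ : ℕ → Raw) (t : Raw) :
    (t.subst σ).subst τ = t.subst fun n => (σ n).subst τ := by
  refine eq_of_bisim
    (fun x y => ∃ σ τ t, x = subst τ (subst σ t) ∧ y = subst (fun n => (σ n).subst τ) t) ?_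
    ⟨σ, τ, t, rfl, rfl⟩
  rintro _ _ ⟨σ, τ, t, rfl, rfl⟩
  cases t using Raw.cases with
  | star => rw [subst_star, subst_star, subst_star]; exact .refl _
  | var n => rw [subst_var, subst_var]; exact .refl _
  | lam u => rw [subst_lam, subst_lam, subst_lam, up_subst]; exact .lam ⟨_, _, _, rfl, rfl⟩
  | app u v =>
    rw [subst_app, subst_app, subst_app]
    exact .app ⟨_, _, _, rfl, rfl⟩ ⟨_, _, _, rfl, rfl⟩

theorem subst_instSub (σ : ℕ → Raw) (u v : Raw) :
    (u.subst (instSub v)).subst σ = (u.subst (up σ)).subst (instSub (v.subst σ)) := by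
  rw [subst_subst, subst_subst]
  congr 1
  funext n
  cases n with
  | zero => simp only [instSub, up, subst_var]
  | succ n =>
    simp only [instSub, up, subst_var, subst_rename]
    exact (subst_id _).symm

variable {a b c : Bool}

theorem trunc_zero (t : Raw) : t.trunc a b c 0 = star := by
  rw [trunc, unfold_eq]
  rfl

theorem trunc_star (d : ℕ) : star.trunc a b c d = star := by
  cases d with
  | zero => exact trunc_zero _
  | succ d =>
    rw [trunc, unfold_eq]
    simp only [truncStep, star, dest_mk, Node.map]

theorem trunc_var (d n : ℕ) : (var n).trunc a b c (d + 1) = var n := by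
  rw [trunc, unfold_eq]
  simp only [truncStep, var, dest_mk, Node.map]

theorem trunc_lam (d : ℕ) (u : Raw) :
    (lam u).trunc a b c (d + 1) = lam (u.trunc a b c (d + 1 - a.toNat)) := by
  conv_lhs => rw [trunc, unfold_eq]
  simp only [truncStep, lam, dest_mk, Node.map, trunc]

theorem trunc_app (d : ℕ) (u v : Raw) : (app u v).trunc a b c (d + 1) =
    app (u.trunc a b c (d + 1 - b.toNat)) (v.trunc a b c (d + 1 - c.toNat)) := by
  conv_lhs => rw [trunc, unfold_eq]
  simp only [truncStep, app, dest_mk, Node.map, trunc]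

theorem trunc_trunc_of_le {e d : ℕ} (h : e ≤ d) (t : Raw) :
    (t.trunc a b c d).trunc a b c e = t.trunc a b c e := by
  refine eq_of_bisim
    (fun x y => ∃ e d t, e ≤ d ∧ x = trunc a b c e (trunc a b c d t) ∧ y = trunc a b c e t) ?_
    ⟨e, d, t, h, rfl, rfl⟩
  rintro _ _ ⟨_ | e, _ | d, t, h, rfl, rfl⟩
  · rw [trunc_zero, trunc_zero]; exact .refl _
  · rw [trunc_zero, trunc_zero]; exact .refl _
  · exact absurd h e.succ_pos.not_ge
  cases t using Raw.cases with
  | star => rw [trunc_star, trunc_star]; exact .refl _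
  | var n => rw [trunc_var, trunc_var]; exact .refl _
  | lam u =>
    rw [trunc_lam, trunc_lam, trunc_lam]
    exact .lam ⟨_, _, _, Nat.sub_le_sub_right h _, rfl, rfl⟩
  | app u v =>
    rw [trunc_app, trunc_app, trunc_app]
    exact .app ⟨_, _, _, Nat.sub_le_sub_right h _, rfl, rfl⟩
      ⟨_, _, _, Nat.sub_le_sub_right h _, rfl, rfl⟩

theorem trunc_eq_of_le {e d : ℕ} (h : e ≤ d) {s t : Raw}
    (hst : s.trunc a b c d = t.trunc a b c d) : s.trunc a b c e = t.trunc a b c e := by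
  rw [← trunc_trunc_of_le h s, hst, trunc_trunc_of_le h]

theorem eq_of_forall_trunc_eq {s t : Raw} (h : ∀ d, s.trunc a b c d = t.trunc a b c d) :
    s = t := by
  refine eq_of_bisim (fun x y => ∀ d, x.trunc a b c d = y.trunc a b c d) (fun s t h => ?_) h
  have of_succ_sub (e : Bool) {u v : Raw}
      (h : ∀ d, u.trunc a b c (d + 1 - e.toNat) = v.trunc a b c (d + 1 - e.toNat)) (d : ℕ) :
      u.trunc a b c d = v.trunc a b c d :=
    trunc_eq_of_le (by have := e.toNat_le; omega) (h d)
  cases s using Raw.cases <;> cases t using Raw.cases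
  case star.star => exact .refl _
  case var.var m n =>
    rw [show m = n by simpa only [trunc_var, var_inj] using h 1]
    exact .refl _
  case lam.lam u u' =>
    have hu d := lam_inj.1 ((trunc_lam d u).symm.trans ((h (d + 1)).trans (trunc_lam d u')))
    exact .lam (of_succ_sub a hu)
  case app.app u v u' v' =>
    have huv d := app_inj.1 ((trunc_app d u v).symm.trans ((h (d + 1)).trans (trunc_app d u' v')))
    exact .app (of_succ_sub b fun d => (huv d).1) (of_succ_sub c fun d => (huv d).2)
  all_goals
    have h₁ := h 1
    simp only [trunc_star, trunc_var, trunc_lam, trunc_app] at h₁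
    simp [star, var, lam, app, mk_inj] at h₁

end Raw

/-! ### Terms -/

namespace Term

variable {a b c : Bool}

theorem lam_inj {u v : Term a b c} : lam u = lam v ↔ u = v :=
  Subtype.ext_iff.trans (Raw.lam_inj.trans Subtype.ext_iff.symm)

theorem app_inj {u v u' v' : Term a b c} : app u v = app u' v' ↔ u = u' ∧ v = v' :=
  Subtype.ext_iff.trans <|
    Raw.app_inj.trans (and_congr Subtype.ext_iff.symm Subtype.ext_iff.symm)

theorem var_ne_lam {n : ℕ} {u : Term a b c} : var n ≠ lam u :=
  Subtype.ext_iff.not.2 Raw.var_ne_lam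

theorem var_ne_app {n : ℕ} {u v : Term a b c} : var n ≠ app u v :=
  Subtype.ext_iff.not.2 Raw.var_ne_app

theorem lam_ne_app {w u v : Term a b c} : lam w ≠ app u v :=
  Subtype.ext_iff.not.2 Raw.lam_ne_app

@[elab_as_elim]
theorem induction {P : Term a b c → Prop} (var : ∀ n, P (var n))
    (lam : ∀ u, (a = false → P u) → P (lam u))
    (app : ∀ u v, (b = false → P u) → (c = false → P v) → P (app u v)) (t : Term a b c) : P t := by
  have key : termSet a b c ≤ {t | ∀ h : t ∈ termSet a b c, P ⟨t, h⟩} := by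
    refine nuMu_le_of_inf ?_
    rintro _ (n | hu | ⟨hu, hv⟩) _
    · exact var n
    · obtain ⟨hu, ihu⟩ := mem_later_inf.1 hu
      exact lam ⟨_, hu⟩ fun ha => ihu ha hu
    · obtain ⟨hu, ihu⟩ := mem_later_inf.1 hu
      obtain ⟨hv, ihv⟩ := mem_later_inf.1 hv
      exact app ⟨_, hu⟩ ⟨_, hv⟩ (fun hb => ihu hb hu) fun hc => ihv hc hv
  exact key t.2 t.2

@[elab_as_elim]
theorem cases {P : Term a b c → Prop} (var : ∀ n, P (var n)) (lam : ∀ u, P (lam u))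
    (app : ∀ u v, P (app u v)) (t : Term a b c) : P t := by
  induction t using Term.induction with
  | var n => exact var n
  | lam u _ => exact lam u
  | app u v _ _ => exact app u v

/-- Renaming of the free variables of a term. -/
def rename (ρ : ℕ → ℕ) (t : Term a b c) : Term a b c := ⟨t.1.rename ρ, rename_mem t.2 ρ⟩

/-- Simultaneous capture-avoiding substitution of terms in a term. -/
def subst (σ : ℕ → Term a b c) (t : Term a b c) : Term a b c :=
  ⟨t.1.subst fun n => (σ n).1, subst_mem t.2 _ fun n => (σ n).2⟩

/-- Extension of a substitution of terms below a binder. -/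
def up (σ : ℕ → Term a b c) : ℕ → Term a b c
  | 0 => var 0
  | n + 1 => (σ n).rename Nat.succ

/-- The substitution sending the variable `0` to `v` and lowering all the other variables. -/
def instSub (v : Term a b c) : ℕ → Term a b c
  | 0 => v
  | n + 1 => var n

theorem rename_lam (ρ : ℕ → ℕ) (u : Term a b c) :
    (lam u).rename ρ = lam (u.rename (Raw.liftRen ρ)) :=
  Subtype.ext (InfLam.rename_lam ρ u.1)

theorem rename_app (ρ : ℕ → ℕ) (u v : Term a b c) :
    (app u v).rename ρ = app (u.rename ρ) (v.rename ρ) :=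
  Subtype.ext (InfLam.rename_app ρ u.1 v.1)

theorem val_up (σ : ℕ → Term a b c) : (fun n => (up σ n).1) = Raw.up fun n => (σ n).1 := by
  funext n
  cases n <;> rfl

theorem subst_var (σ : ℕ → Term a b c) (n : ℕ) : (var n).subst σ = σ n :=
  Subtype.ext (InfLam.subst_var _ n)

theorem subst_lam (σ : ℕ → Term a b c) (u : Term a b c) :
    (lam u).subst σ = lam (u.subst (up σ)) :=
  Subtype.ext <| by simp only [subst, lam, val_up, InfLam.subst_lam]

theorem subst_app (σ : ℕ → Term a b c) (u v : Term a b c) :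
    (app u v).subst σ = app (u.subst σ) (v.subst σ) :=
  Subtype.ext (InfLam.subst_app _ u.1 v.1)

theorem rename_eq_subst (ρ : ℕ → ℕ) (t : Term a b c) :
    t.rename ρ = t.subst fun n => var (ρ n) :=
  Subtype.ext (Raw.rename_eq_subst ρ t.1)

theorem subst_inst (σ : ℕ → Term a b c) (u v : Term a b c) :
    (inst u v).subst σ = inst (u.subst (up σ)) (v.subst σ) :=
  Subtype.ext <| by simp only [subst, inst, val_up, Raw.subst_instSub]

theorem inst_eq_subst (u v : Term a b c) : inst u v = u.subst (instSub v) := by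
  refine Subtype.ext (congrArg (u.1.subst ·) ?_)
  funext n
  cases n <;> rfl

/-- `s` and `t` agree at depth `d`: they have the same `abc`-truncation at depth `d`. -/
def Agree (d : ℕ) (s t : Term a b c) : Prop := s.1.trunc a b c d = t.1.trunc a b c d

theorem agree_zero (s t : Term a b c) : Agree 0 s t := by
  rw [Agree, Raw.trunc_zero, Raw.trunc_zero]

theorem Agree.mono {d e : ℕ} (h : e ≤ d) {s t : Term a b c} (hst : Agree d s t) : Agree e s t :=
  Raw.trunc_eq_of_le h hst

theorem agree_lam_iff {d : ℕ} {u u' : Term a b c} :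
    Agree d (lam u) (lam u') ↔ Agree (d - a.toNat) u u' := by
  cases d with
  | zero => simp only [Nat.zero_sub, agree_zero]
  | succ d => rw [Agree, lam, lam, Raw.trunc_lam, Raw.trunc_lam, Raw.lam_inj, Agree]

theorem agree_app_iff {d : ℕ} {u u' v v' : Term a b c} :
    Agree d (app u v) (app u' v') ↔ Agree (d - b.toNat) u u' ∧ Agree (d - c.toNat) v v' := by
  cases d with
  | zero => simp only [Nat.zero_sub, agree_zero, and_self]
  | succ d => rw [Agree, app, app, Raw.trunc_app, Raw.trunc_app, Raw.app_inj, Agree, Agree]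

theorem Agree.eq_var {n : ℕ} {s : Term a b c} (h : Agree 1 s (var n)) : s = var n := by
  cases s using Term.cases <;>
    simp only [Agree, Term.lam, Term.app, Term.var, Raw.trunc_var, Raw.trunc_lam, Raw.trunc_app]
      at h
  case var m => rw [Raw.var_inj.1 h]
  all_goals simp [Raw.var, Raw.lam, Raw.app, Raw.mk_inj] at h

theorem Agree.exists_eq_lam {s u : Term a b c} (h : Agree 1 s (lam u)) :
    ∃ u', s = Term.lam u' := by
  cases s using Term.cases <;>
    simp only [Agree, Term.lam, Term.app, Term.var, Raw.trunc_var, Raw.trunc_lam, Raw.trunc_app]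
      at h
  case lam u' => exact ⟨u', rfl⟩
  all_goals simp [Raw.var, Raw.lam, Raw.app, Raw.mk_inj] at h

theorem Agree.exists_eq_app {s u v : Term a b c} (h : Agree 1 s (app u v)) :
    ∃ u' v', s = Term.app u' v' := by
  cases s using Term.cases <;>
    simp only [Agree, Term.lam, Term.app, Term.var, Raw.trunc_var, Raw.trunc_lam, Raw.trunc_app]
      at h
  case app u' v' => exact ⟨u', v', rfl⟩
  all_goals simp [Raw.var, Raw.lam, Raw.app, Raw.mk_inj] at h

theorem eq_of_forall_agree {s t : Term a b c} (h : ∀ d, Agree d s t) : s = t :=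
  Subtype.ext (Raw.eq_of_forall_trunc_eq h)

theorem Agree.dist_le {d : ℕ} {s t : Term a b c} (h : Agree d s t) : dist s t ≤ (1 / 2) ^ d := by
  refine csInf_le ⟨0, ?_⟩ ⟨d, rfl, h⟩
  rintro _ ⟨e, rfl, -⟩
  positivity

theorem agree_of_dist_lt {d : ℕ} {s t : Term a b c} (h : dist s t < (1 / 2) ^ d) :
    Agree d s t := by
  have hne : {x : ℝ | ∃ e : ℕ, x = (1 / 2) ^ e ∧ Agree e s t}.Nonempty :=
    ⟨1, 0, (pow_zero _).symm, agree_zero s t⟩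
  obtain ⟨_, ⟨e, rfl, he⟩, hlt⟩ := exists_lt_of_csInf_lt hne h
  refine he.mono (le_of_lt ?_)
  exact (pow_lt_pow_iff_right_of_lt_one₀ (by norm_num) (by norm_num)).1 hlt

end Term

variable {a b c : Bool}

/-! ### Finite reductions -/

theorem BetaAt.subst {d : ℕ} {s t : Term a b c} (h : BetaAt d s t) (σ : ℕ → Term a b c) :
    BetaAt d (s.subst σ) (t.subst σ) := by
  induction h generalizing σ with
  | beta u v =>
    rw [Term.subst_app, Term.subst_lam, Term.subst_inst]
    exact .beta _ _
  | lam _ ih =>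
    rw [Term.subst_lam, Term.subst_lam]
    exact .lam (ih _)
  | appL _ ih =>
    rw [Term.subst_app, Term.subst_app]
    exact .appL (ih _)
  | appR _ ih =>
    rw [Term.subst_app, Term.subst_app]
    exact .appR (ih _)

theorem BetaStar.subst {s t : Term a b c} (h : BetaStar s t) (σ : ℕ → Term a b c) :
    BetaStar (s.subst σ) (t.subst σ) :=
  Relation.ReflTransGen.lift _ (fun _ _ ⟨d, h⟩ => ⟨d, h.subst σ⟩) _ _ h

theorem BetaStar.rename {s t : Term a b c} (h : BetaStar s t) (ρ : ℕ → ℕ) :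
    BetaStar (s.rename ρ) (t.rename ρ) := by
  rw [Term.rename_eq_subst, Term.rename_eq_subst]
  exact h.subst _

theorem BetaStar.appL {u u' : Term a b c} (h : BetaStar u u') (v : Term a b c) :
    BetaStar (Term.app u v) (Term.app u' v) :=
  Relation.ReflTransGen.lift (Term.app · v) (fun _ _ ⟨_, h⟩ => ⟨_, h.appL⟩) _ _ h

/-! ### The standard presentation -/

namespace RedStd

theorem fold : StdRule RedStd RedStd = (RedStd : Term a b c → Term a b c → Prop) :=
  nuMu_fold StdRule stdRule_mono

theorem var_iff {s : Term a b c} {n : ℕ} : RedStd s (Term.var n) ↔ BetaStar s (Term.var n) := by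
  rw [← fold]
  refine ⟨fun h => ?_, .var⟩
  generalize ht : Term.var n = t at h
  rcases h with h | _ | _
  · exact h
  · exact absurd ht Term.var_ne_lam
  · exact absurd ht Term.var_ne_app

theorem lam_iff {s u' : Term a b c} :
    RedStd s (Term.lam u') ↔ ∃ u, BetaStar s (Term.lam u) ∧ RedStd u u' := by
  constructor
  · intro h
    rw [← fold] at h
    generalize ht : Term.lam u' = t at h
    rcases h with _ | ⟨hs, hu⟩ | _
    · exact absurd ht.symm Term.var_ne_lam
    · rw [later_self, ← Term.lam_inj.1 ht] at hu
      exact ⟨_, hs, hu⟩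
    · exact absurd ht Term.lam_ne_app
  · rintro ⟨u, hs, hu⟩
    rw [← fold]
    exact .lam hs (by rwa [later_self])

theorem app_iff {s u' v' : Term a b c} :
    RedStd s (Term.app u' v') ↔
      ∃ u v, BetaStar s (Term.app u v) ∧ RedStd u u' ∧ RedStd v v' := by
  constructor
  · intro h
    rw [← fold] at h
    generalize ht : Term.app u' v' = t at h
    rcases h with _ | _ | ⟨hs, hu, hv⟩
    · exact absurd ht.symm Term.var_ne_app
    · exact absurd ht.symm Term.lam_ne_app
    · rw [later_self, ← (Term.app_inj.1 ht).1] at hu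
      rw [later_self, ← (Term.app_inj.1 ht).2] at hv
      exact ⟨_, _, hs, hu, hv⟩
  · rintro ⟨u, v, hs, hu, hv⟩
    rw [← fold]
    exact .app hs (by rwa [later_self]) (by rwa [later_self])

@[elab_as_elim]
theorem induction {P : ∀ s t : Term a b c, RedStd s t → Prop}
    (var : ∀ s n (hs : BetaStar s (Term.var n)), P s (Term.var n) (var_iff.2 hs))
    (lam : ∀ s u u' (hs : BetaStar s (Term.lam u)) (hu : RedStd u u'),
      (a = false → P u u' hu) → P s (Term.lam u') (lam_iff.2 ⟨u, hs, hu⟩))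
    (app : ∀ s u u' v v' (hs : BetaStar s (Term.app u v)) (hu : RedStd u u') (hv : RedStd v v'),
      (b = false → P u u' hu) → (c = false → P v v' hv) →
        P s (Term.app u' v') (app_iff.2 ⟨u, v, hs, hu, hv⟩))
    {s t : Term a b c} (h : RedStd s t) : P s t h := by
  have key : RedStd ≤ fun s t : Term a b c => ∀ h : RedStd s t, P s t h := by
    refine nuMu_le_of_inf ?_
    rintro s t (hs | ⟨hs, hu⟩ | ⟨hs, hu, hv⟩) _
    · exact var _ _ hs
    · obtain ⟨hu, ihu⟩ := later_inf_apply_iff.1 hu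
      exact lam _ _ _ hs hu fun ha => ihu ha hu
    · obtain ⟨hu, ihu⟩ := later_inf_apply_iff.1 hu
      obtain ⟨hv, ihv⟩ := later_inf_apply_iff.1 hv
      exact app _ _ _ _ _ hs hu hv (fun hb => ihu hb hu) fun hc => ihv hc hv
  exact key _ _ h h

/-- A partial derivation in the standard presentation: its open leaves are pairs related by `C`,
and each of them lies above a coinductive premiss. -/
inductive Guarded (C : Term a b c → Term a b c → Prop) : Term a b c → Term a b c → Prop
  | of_redStd {s t : Term a b c} : RedStd s t → Guarded C s t
  | lam {s u u' : Term a b c} : BetaStar s (Term.lam u) → (a = false → Guarded C u u') →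
      (a = true → C u u') → Guarded C s (Term.lam u')
  | app {s u u' v v' : Term a b c} : BetaStar s (Term.app u v) → (b = false → Guarded C u u') →
      (b = true → C u u') → (c = false → Guarded C v v') → (c = true → C v v') →
      Guarded C s (Term.app u' v')

theorem coinduction {C : Term a b c → Term a b c → Prop} (hC : ∀ s t, C s t → Guarded C s t)
    {s t : Term a b c} (h : C s t) : RedStd s t := by
  refine (le_nuMu_of_sup fun I hν hI s t hst => ?_ : C ≤ RedStd) s t h
  replace hst := hC s t hst
  clear h
  induction hst with
  | of_redStd h => exact hν _ _ h
  | lam hs _ h₁ ih => exact hI _ _ (.lam hs (later_apply_iff.2 ⟨ih, fun e => .inl (h₁ e)⟩))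
  | app hs _ hu₁ _ hv₁ ihu ihv =>
    exact hI _ _ (.app hs (later_apply_iff.2 ⟨ihu, fun e => .inl (hu₁ e)⟩)
      (later_apply_iff.2 ⟨ihv, fun e => .inl (hv₁ e)⟩))

theorem head {s s' t : Term a b c} (h : BetaStar s s') (h' : RedStd s' t) : RedStd s t := by
  rw [← fold] at h' ⊢
  rcases h' with h₁ | ⟨h₁, hu⟩ | ⟨h₁, hu, hv⟩
  · exact .var (h.trans h₁)
  · exact .lam (h.trans h₁) hu
  · exact .app (h.trans h₁) hu hv

protected theorem refl (s : Term a b c) : RedStd s s := by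
  refine coinduction (C := Eq) ?_ rfl
  rintro s _ rfl
  induction s using Term.induction with
  | var n => exact .of_redStd (var_iff.2 .refl)
  | lam u ih => exact .lam .refl ih fun _ => rfl
  | app u v ihu ihv => exact .app .refl ihu (fun _ => rfl) ihv fun _ => rfl

theorem of_betaStar {s t : Term a b c} (h : BetaStar s t) : RedStd s t := head h (.refl t)

theorem rename {s t : Term a b c} (h : RedStd s t) (ρ : ℕ → ℕ) :
    RedStd (s.rename ρ) (t.rename ρ) := by
  refine coinduction
    (C := fun x y => ∃ s t ρ, RedStd s t ∧ Term.rename ρ s = x ∧ Term.rename ρ t = y) ?_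
    ⟨s, t, ρ, h, rfl, rfl⟩
  rintro _ _ ⟨s, t, ρ, h, rfl, rfl⟩
  induction h using RedStd.induction generalizing ρ with
  | var s n hs => exact .of_redStd (of_betaStar (hs.rename ρ))
  | lam s u u' hs hu ih =>
    have hs := hs.rename ρ
    rw [Term.rename_lam] at hs ⊢
    exact .lam hs (ih · _) fun _ => ⟨_, _, _, hu, rfl, rfl⟩
  | app s u u' v v' hs hu hv ihu ihv =>
    have hs := hs.rename ρ
    rw [Term.rename_app] at hs ⊢
    exact .app hs (ihu · _) (fun _ => ⟨_, _, _, hu, rfl, rfl⟩) (ihv · _)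
      fun _ => ⟨_, _, _, hv, rfl, rfl⟩

theorem up {σ τ : ℕ → Term a b c} (h : ∀ n, RedStd (σ n) (τ n)) (n : ℕ) :
    RedStd (Term.up σ n) (Term.up τ n) := by
  cases n with
  | zero => exact .refl _
  | succ n => exact (h n).rename _

theorem subst {s t : Term a b c} (h : RedStd s t) {σ τ : ℕ → Term a b c}
    (hστ : ∀ n, RedStd (σ n) (τ n)) : RedStd (s.subst σ) (t.subst τ) := by
  refine coinduction
    (C := fun x y => ∃ s t σ τ, RedStd s t ∧ (∀ n, RedStd (σ n) (τ n)) ∧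
      Term.subst σ s = x ∧ Term.subst τ t = y) ?_ ⟨s, t, σ, τ, h, hστ, rfl, rfl⟩
  rintro _ _ ⟨s, t, σ, τ, h, hστ, rfl, rfl⟩
  induction h using RedStd.induction generalizing σ τ with
  | var s n hs =>
    have hs := hs.subst σ
    rw [Term.subst_var] at hs ⊢
    exact .of_redStd (head hs (hστ n))
  | lam s u u' hs hu ih =>
    have hs := hs.subst σ
    rw [Term.subst_lam] at hs ⊢
    exact .lam hs (ih · _ _ (up hστ)) fun _ => ⟨_, _, _, _, hu, up hστ, rfl, rfl⟩
  | app s u u' v v' hs hu hv ihu ihv =>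
    have hs := hs.subst σ
    rw [Term.subst_app] at hs ⊢
    exact .app hs (ihu · _ _ hστ) (fun _ => ⟨_, _, _, _, hu, hστ, rfl, rfl⟩) (ihv · _ _ hστ)
      fun _ => ⟨_, _, _, _, hv, hστ, rfl, rfl⟩

theorem inst {u u' v v' : Term a b c} (hu : RedStd u u') (hv : RedStd v v') :
    RedStd (Term.inst u v) (Term.inst u' v') := by
  rw [Term.inst_eq_subst, Term.inst_eq_subst]
  refine hu.subst fun n => ?_
  cases n with
  | zero => exact hv
  | succ n => exact .refl _

theorem tail_betaAt {d : ℕ} {s t t' : Term a b c} (h : RedStd s t) (ht : BetaAt d t t') :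
    RedStd s t' := by
  induction ht generalizing s with
  | beta u' v' =>
    obtain ⟨p, v, hs, hp, hv⟩ := app_iff.1 h
    obtain ⟨u, hp, hu⟩ := lam_iff.1 hp
    exact head ((hs.trans (hp.appL v)).tail ⟨0, .beta u v⟩) (hu.inst hv)
  | lam _ ih =>
    obtain ⟨u, hs, hu⟩ := lam_iff.1 h
    exact lam_iff.2 ⟨u, hs, ih hu⟩
  | appL _ ih =>
    obtain ⟨u, v, hs, hu, hv⟩ := app_iff.1 h
    exact app_iff.2 ⟨u, v, hs, ih hu, hv⟩
  | appR _ ih =>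
    obtain ⟨u, v, hs, hu, hv⟩ := app_iff.1 h
    exact app_iff.2 ⟨u, v, hs, hu, ih hv⟩

theorem tail {s t t' : Term a b c} (h : RedStd s t) (ht : BetaStar t t') : RedStd s t' := by
  induction ht with
  | refl => exact h
  | tail _ ht ih => exact tail_betaAt ih ht.choose_spec

protected theorem trans {r s t : Term a b c} (h : RedStd r s) (h' : RedStd s t) : RedStd r t := by
  refine coinduction (C := fun r t => ∃ s, RedStd r s ∧ RedStd s t) ?_ ⟨s, h, h'⟩
  rintro r t ⟨s, h, h'⟩
  induction h' using RedStd.induction generalizing r with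
  | var s n hs => exact .of_redStd (h.tail hs)
  | lam s u u' hs hu ih =>
    obtain ⟨p, hr, hp⟩ := lam_iff.1 (h.tail hs)
    exact .lam hr (ih · _ hp) fun _ => ⟨u, hp, hu⟩
  | app s u u' v v' hs hu hv ihu ihv =>
    obtain ⟨p, q, hr, hp, hq⟩ := app_iff.1 (h.tail hs)
    exact .app hr (ihu · _ hp) (fun _ => ⟨u, hp, hu⟩) (ihv · _ hq) fun _ => ⟨v, hq, hv⟩

end RedStd

/-! ### The presentation with ordinal annotations -/

theorem redIG_eq (γ : Ordinal.{0}) :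
    (RedIG γ : Term a b c → Term a b c → Prop) = Lift (RedI γ) (RedI γ) := by
  rw [RedIG]
  simp only [exists_prop]
  rfl

theorem stdRule_le_splitLift (G X₀ X₁ : Term a b c → Term a b c → Prop) :
    StdRule X₀ X₁ ≤ SplitLift G X₀ X₁ := by
  rintro s t (hs | ⟨hs, hu⟩ | ⟨hs, hu, hv⟩)
  · exact ⟨0, _, .zero hs, .var _⟩
  · exact ⟨0, _, .zero hs, .lam hu⟩
  · exact ⟨0, _, .zero hs, .app hu hv⟩

theorem redStd_le_redOf (G : Term a b c → Term a b c → Prop) : RedStd ≤ RedOf G :=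
  nuMu_mono (stdRule_le_splitLift G)

theorem SeqOf.redStd {G : Term a b c → Term a b c → Prop} (hG : G ≤ RedStd)
    {m : ℕ} {s t : Term a b c} (h : SeqOf G m s t) : RedStd s t := by
  induction h with
  | zero hs => exact .of_betaStar hs
  | succ hs ht _ ih => exact .head hs ((hG _ _ ht).trans ih)

theorem redOf_le_redStd {G : Term a b c → Term a b c → Prop} (hG : G ≤ RedStd) :
    RedOf G ≤ RedStd := by
  let C (r t : Term a b c) : Prop := ∃ s, RedStd r s ∧ RedOf G s t
  have guarded : RedOf G ≤ fun s t => ∀ r, RedStd r s → RedStd.Guarded C r t := by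
    refine nuMu_le _ _ _ ?_
    rintro s t ⟨m, s', hs, h⟩ r hr
    replace hr : RedStd r s' := hr.trans (hs.redStd hG)
    rcases h with n | hu | ⟨hu, hv⟩
    · exact .of_redStd hr
    · obtain ⟨p, hr, hp⟩ := RedStd.lam_iff.1 hr
      obtain ⟨hu₀, hu₁⟩ := later_apply_iff.1 hu
      exact .lam hr (hu₀ · _ hp) fun e => ⟨_, hp, hu₁ e⟩
    · obtain ⟨p, q, hr, hp, hq⟩ := RedStd.app_iff.1 hr
      obtain ⟨hu₀, hu₁⟩ := later_apply_iff.1 hu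
      obtain ⟨hv₀, hv₁⟩ := later_apply_iff.1 hv
      exact .app hr (hu₀ · _ hp) (fun e => ⟨_, hp, hu₁ e⟩) (hv₀ · _ hq) fun e => ⟨_, hq, hv₁ e⟩
  intro s t h
  exact RedStd.coinduction (C := C) (fun r t ⟨s, hr, h⟩ => guarded s t h r hr) ⟨s, .refl s, h⟩

theorem redI_iff_redStd {γ : Ordinal.{0}} {s t : Term a b c} : RedI γ s t ↔ RedStd s t := by
  refine ⟨?_, redStd_le_redOf _ s t⟩
  induction γ using WellFoundedLT.induction generalizing s t with
  | ind γ ih =>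
    refine redOf_le_redStd ?_ s t
    rintro s t ⟨δ, hδ, h⟩
    rw [redIG_eq] at h
    rcases h with n | hu | ⟨hu, hv⟩
    · exact .refl _
    · rw [later_self] at hu
      exact RedStd.lam_iff.2 ⟨_, .refl, ih δ hδ hu⟩
    · rw [later_self] at hu hv
      exact RedStd.app_iff.2 ⟨_, _, .refl, ih δ hδ hu, ih δ hδ hv⟩

theorem RedI.tail {γ : Ordinal.{0}} {s t t' : Term a b c} (h : RedI γ s t) (ht : Beta t t') :
    RedI γ s t' :=
  redI_iff_redStd.2 ((redI_iff_redStd.1 h).tail (.single ht))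

/-! ### From strongly converging sequences to the standard presentation -/

/-- A β-step at depth at least `N`. -/
def StepFrom (N : ℕ) (s t : Term a b c) : Prop := ∃ d, N ≤ d ∧ BetaAt d s t

theorem StepFrom.mono {M N : ℕ} (h : M ≤ N) {s t : Term a b c} :
    StepFrom N s t → StepFrom M s t :=
  fun ⟨d, hd, hst⟩ => ⟨d, h.trans hd, hst⟩

/-- At most one β-step, at depth at least `N`. Void steps appear in the sequence of the functions
of a sequence of applications, when the arguments are reduced. -/
def QuasiStep (N : ℕ) (s t : Term a b c) : Prop := s = t ∨ StepFrom N s t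

namespace QuasiStep

variable {N : ℕ} {u u' v v' : Term a b c}

theorem mono {M : ℕ} (h : M ≤ N) {s t : Term a b c} : QuasiStep N s t → QuasiStep M s t :=
  Or.imp_right (StepFrom.mono h)

theorem of_lam (h : QuasiStep N (Term.lam u) (Term.lam u')) : QuasiStep (N - a.toNat) u u' := by
  rcases h with h | ⟨d, hd, h⟩
  · exact .inl (Term.lam_inj.1 h)
  · generalize hs : Term.lam u = s, ht : Term.lam u' = t at h
    rcases h with _ | h | h | h
    · exact absurd hs Term.lam_ne_app
    · rw [Term.lam_inj.1 hs, Term.lam_inj.1 ht]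
      exact .inr ⟨_, by lia, h⟩
    · exact absurd hs Term.lam_ne_app
    · exact absurd hs Term.lam_ne_app

theorem of_app (hN : 1 ≤ N) (h : QuasiStep N (Term.app u v) (Term.app u' v')) :
    QuasiStep (N - b.toNat) u u' ∧ QuasiStep (N - c.toNat) v v' := by
  rcases h with h | ⟨d, hd, h⟩
  · exact (Term.app_inj.1 h).imp .inl .inl
  · generalize hs : Term.app u v = s, ht : Term.app u' v' = t at h
    rcases h with _ | h | h | h
    · lia
    · exact absurd hs.symm Term.lam_ne_app
    all_goals
      obtain ⟨rfl, rfl⟩ := Term.app_inj.1 hs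
      obtain ⟨rfl, rfl⟩ := Term.app_inj.1 ht
    · exact ⟨.inr ⟨_, by lia, h⟩, .inl rfl⟩
    · exact ⟨.inl rfl, .inr ⟨_, by lia, h⟩⟩

end QuasiStep

/-- On the interval `[α, γ]`, the sequence `s` only has steps at depth at least `N`, and its terms
agree at depth `N` with the last one. -/
structure Stable (N : ℕ) (α γ : Ordinal.{0}) (s : Ordinal.{0} → Term a b c) : Prop where
  step : ∀ δ, α ≤ δ → δ < γ → QuasiStep N (s δ) (s (δ + 1))
  agree : ∀ δ, α ≤ δ → δ ≤ γ → Term.Agree N (s δ) (s γ)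

/-- A strongly converging sequence indexed by the interval `[α, γ]`, where steps may be void. -/
structure Converges (α γ : Ordinal.{0}) (s : Ordinal.{0} → Term a b c) : Prop where
  step : ∀ δ, α ≤ δ → δ < γ → QuasiStep 0 (s δ) (s (δ + 1))
  limit : ∀ γ', α < γ' → γ' ≤ γ → Order.IsSuccLimit γ' → ∀ N : ℕ,
    ∃ β, α ≤ β ∧ β < γ' ∧ Stable N β γ' s

section

variable {N : ℕ} {α γ : Ordinal.{0}} {s u v : Ordinal.{0} → Term a b c}

namespace Stable

theorem mono {M : ℕ} (h : M ≤ N) (hs : Stable N α γ s) : Stable M α γ s where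
  step δ h₁ h₂ := (hs.step δ h₁ h₂).mono h
  agree δ h₁ h₂ := (hs.agree δ h₁ h₂).mono h

theorem restrict {β : Ordinal.{0}} (h : α ≤ β) (hs : Stable N α γ s) : Stable N β γ s where
  step δ h₁ := hs.step δ (h.trans h₁)
  agree δ h₁ := hs.agree δ (h.trans h₁)

theorem of_lam (hs : Stable N α γ s) (hu : ∀ δ, α ≤ δ → δ ≤ γ → s δ = Term.lam (u δ)) :
    Stable (N - a.toNat) α γ u where
  step δ h₁ h₂ := by
    have h := hs.step δ h₁ h₂
    rw [hu δ h₁ h₂.le, hu (δ + 1) (h₁.trans le_self_add) (Order.add_one_le_of_lt h₂)] at h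
    exact h.of_lam
  agree δ h₁ h₂ := by
    have h := hs.agree δ h₁ h₂
    rw [hu δ h₁ h₂, hu γ (h₁.trans h₂) le_rfl] at h
    exact Term.agree_lam_iff.1 h

theorem of_app (hN : 1 ≤ N) (hs : Stable N α γ s)
    (huv : ∀ δ, α ≤ δ → δ ≤ γ → s δ = Term.app (u δ) (v δ)) :
    Stable (N - b.toNat) α γ u ∧ Stable (N - c.toNat) α γ v := by
  have step (δ) (h₁ : α ≤ δ) (h₂ : δ < γ) :
      QuasiStep (N - b.toNat) (u δ) (u (δ + 1)) ∧ QuasiStep (N - c.toNat) (v δ) (v (δ + 1)) := by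
    have h := hs.step δ h₁ h₂
    rw [huv δ h₁ h₂.le, huv (δ + 1) (h₁.trans le_self_add) (Order.add_one_le_of_lt h₂)] at h
    exact h.of_app hN
  have agree (δ) (h₁ : α ≤ δ) (h₂ : δ ≤ γ) :
      Term.Agree (N - b.toNat) (u δ) (u γ) ∧ Term.Agree (N - c.toNat) (v δ) (v γ) := by
    have h := hs.agree δ h₁ h₂
    rw [huv δ h₁ h₂, huv γ (h₁.trans h₂) le_rfl] at h
    exact Term.agree_app_iff.1 h
  exact ⟨⟨fun δ h₁ h₂ => (step δ h₁ h₂).1, fun δ h₁ h₂ => (agree δ h₁ h₂).1⟩,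
    ⟨fun δ h₁ h₂ => (step δ h₁ h₂).2, fun δ h₁ h₂ => (agree δ h₁ h₂).2⟩⟩

theorem exists_lam (hs : Stable 1 α γ s) {u' : Term a b c} (hγ : s γ = Term.lam u') :
    ∃ u : Ordinal.{0} → Term a b c, ∀ δ, α ≤ δ → δ ≤ γ → s δ = Term.lam (u δ) := by
  have : Nonempty (Term a b c) := ⟨Term.var 0⟩
  have key (δ) (h₁ : α ≤ δ) (h₂ : δ ≤ γ) : ∃ u, s δ = Term.lam u :=
    Term.Agree.exists_eq_lam (hγ ▸ hs.agree δ h₁ h₂)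
  choose! u hu using key
  exact ⟨u, hu⟩

theorem exists_app (hs : Stable 1 α γ s) {u' v' : Term a b c} (hγ : s γ = Term.app u' v') :
    ∃ u v : Ordinal.{0} → Term a b c, ∀ δ, α ≤ δ → δ ≤ γ → s δ = Term.app (u δ) (v δ) := by
  have : Nonempty (Term a b c) := ⟨Term.var 0⟩
  have key (δ) (h₁ : α ≤ δ) (h₂ : δ ≤ γ) : ∃ u v, s δ = Term.app u v :=
    Term.Agree.exists_eq_app (hγ ▸ hs.agree δ h₁ h₂)
  choose! u v huv using key
  exact ⟨u, v, huv⟩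

end Stable

theorem IsStronglyConverging.converges {d : Ordinal.{0} → ℕ} (h : IsStronglyConverging γ s d) :
    Converges 0 γ s where
  step δ _ hδ := .inr ⟨_, Nat.zero_le _, h.step δ hδ⟩
  limit γ' _ hγ hlim N := by
    obtain ⟨δ₁, hδ₁, hterm⟩ := h.tendsto_term γ' hγ hlim ((1 / 2) ^ N) (by positivity)
    obtain ⟨δ₂, hδ₂, hdepth⟩ := h.tendsto_depth γ' hγ hlim N
    refine ⟨max δ₁ δ₂, zero_le, max_lt hδ₁ hδ₂, fun δ h₁ h₂ => ?_, fun δ h₁ h₂ => ?_⟩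
    · exact .inr ⟨_, hdepth δ (le_of_max_le_right h₁) h₂, h.step δ (h₂.trans_le hγ)⟩
    · rcases h₂.lt_or_eq with h₂ | rfl
      · exact Term.agree_of_dist_lt (hterm δ (le_of_max_le_left h₁) h₂)
      · exact rfl

namespace Converges

theorem restrict_right {γ' : Ordinal.{0}} (h : γ' ≤ γ) (hs : Converges α γ s) :
    Converges α γ' s where
  step δ h₁ h₂ := hs.step δ h₁ (h₂.trans_le h)
  limit β h₁ h₂ := hs.limit β h₁ (h₂.trans h)

theorem restrict_left {β : Ordinal.{0}} (h : α ≤ β) (hs : Converges α γ s) :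
    Converges β γ s where
  step δ h₁ h₂ := hs.step δ (h.trans h₁) h₂
  limit γ' h₁ h₂ hγ' N := by
    obtain ⟨δ, -, hδ, hst⟩ := hs.limit γ' (h.trans_lt h₁) h₂ hγ' N
    exact ⟨max β δ, le_max_left _ _, max_lt h₁ hδ, hst.restrict (le_max_right _ _)⟩

theorem of_lam (hs : Converges α γ s) (hu : ∀ δ, α ≤ δ → δ ≤ γ → s δ = Term.lam (u δ)) :
    Converges α γ u where
  step δ h₁ h₂ := by
    have h := hs.step δ h₁ h₂
    rw [hu δ h₁ h₂.le, hu (δ + 1) (h₁.trans le_self_add) (Order.add_one_le_of_lt h₂)] at h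
    exact h.of_lam.mono (Nat.zero_le _)
  limit γ' h₁ h₂ hγ' N := by
    obtain ⟨β, hβ, hβ', hst⟩ := hs.limit γ' h₁ h₂ hγ' (N + a.toNat)
    exact ⟨β, hβ, hβ', (hst.of_lam fun δ h₃ h₄ => hu δ (hβ.trans h₃) (h₄.trans h₂)).mono (by lia)⟩

theorem of_app (hs : Converges α γ s) (hst : Stable 1 α γ s)
    (huv : ∀ δ, α ≤ δ → δ ≤ γ → s δ = Term.app (u δ) (v δ)) :
    Converges α γ u ∧ Converges α γ v := by
  obtain ⟨hu, hv⟩ := hst.of_app le_rfl huv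
  have limit (γ') (h₁ : α < γ') (h₂ : γ' ≤ γ) (hγ' : Order.IsSuccLimit γ') (N : ℕ) :
      ∃ β, α ≤ β ∧ β < γ' ∧ Stable N β γ' u ∧ Stable N β γ' v := by
    obtain ⟨β, hβ, hβ', hst⟩ := hs.limit γ' h₁ h₂ hγ' (N + 1)
    obtain ⟨hu, hv⟩ :=
      hst.of_app (by lia) fun δ h₃ h₄ => huv δ (hβ.trans h₃) (h₄.trans h₂)
    have := b.toNat_le
    have := c.toNat_le
    exact ⟨β, hβ, hβ', hu.mono (by lia), hv.mono (by lia)⟩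
  constructor
  · refine ⟨fun δ h₁ h₂ => (hu.step δ h₁ h₂).mono (Nat.zero_le _), fun γ' h₁ h₂ hγ' N => ?_⟩
    obtain ⟨β, hβ, hβ', hu, -⟩ := limit γ' h₁ h₂ hγ' N
    exact ⟨β, hβ, hβ', hu⟩
  · refine ⟨fun δ h₁ h₂ => (hv.step δ h₁ h₂).mono (Nat.zero_le _), fun γ' h₁ h₂ hγ' N => ?_⟩
    obtain ⟨β, hβ, hβ', -, hv⟩ := limit γ' h₁ h₂ hγ' N
    exact ⟨β, hβ, hβ', hv⟩

end Converges

/-- `LimitRed γ p q`: an infinitary reduction from `p` reaches some term of a strongly converging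
sequence which ends with `q` at the index `γ`. When `γ` is a limit ordinal, this is the
coinduction hypothesis showing that `p` reduces to `q`. -/
def LimitRed (γ : Ordinal.{0}) (p q : Term a b c) : Prop :=
  ∃ α < γ, ∃ s, Converges α γ s ∧ RedStd p (s α) ∧ s γ = q

theorem Converges.guarded_limitRed (hα : α < γ) {p q : Term a b c} (hs : Converges α γ s)
    (hst : Stable 1 α γ s) (hp : RedStd p (s α)) (hq : s γ = q) :
    RedStd.Guarded (LimitRed γ) p q := by
  induction q using Term.induction generalizing p s with
  | var n =>
    have hsα : s α = Term.var n := Term.Agree.eq_var (hq ▸ hst.agree α le_rfl hα.le)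
    exact .of_redStd (hsα ▸ hp)
  | lam u' ih =>
    obtain ⟨u, hu⟩ := hst.exists_lam hq
    obtain rfl : u γ = u' := Term.lam_inj.1 ((hu γ hα.le le_rfl).symm.trans hq)
    rw [hu α le_rfl hα.le] at hp
    obtain ⟨r, hp, hr⟩ := RedStd.lam_iff.1 hp
    have hconv := hs.of_lam hu
    refine .lam hp (fun e => ih e hconv ?_ hr rfl) fun _ => ⟨α, hα, u, hconv, hr, rfl⟩
    exact (hst.of_lam hu).mono (by simp [e])
  | app u' v' ihu ihv =>
    obtain ⟨u, v, huv⟩ := hst.exists_app hq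
    obtain ⟨rfl, rfl⟩ : u γ = u' ∧ v γ = v' :=
      Term.app_inj.1 ((huv γ hα.le le_rfl).symm.trans hq)
    rw [huv α le_rfl hα.le] at hp
    obtain ⟨r, r', hp, hr, hr'⟩ := RedStd.app_iff.1 hp
    obtain ⟨hu, hv⟩ := hs.of_app hst huv
    obtain ⟨hstu, hstv⟩ := hst.of_app le_rfl huv
    refine .app hp (fun e => ihu e hu ?_ hr rfl) (fun _ => ⟨α, hα, u, hu, hr, rfl⟩)
      (fun e => ihv e hv ?_ hr' rfl) fun _ => ⟨α, hα, v, hv, hr', rfl⟩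
    · exact hstu.mono (by simp [e])
    · exact hstv.mono (by simp [e])

theorem LimitRed.redStd (hγ : Order.IsSuccLimit γ)
    (ih : ∀ β < γ, ∀ (α : Ordinal.{0}) (s : Ordinal.{0} → Term a b c), α ≤ β →
      Converges α β s → RedStd (s α) (s β))
    {p q : Term a b c} (h : LimitRed γ p q) : RedStd p q := by
  refine RedStd.coinduction (C := LimitRed γ) ?_ h
  rintro p q ⟨α, hα, s, hs, hp, hq⟩
  obtain ⟨β, hαβ, hβ, hst⟩ := hs.limit γ hα le_rfl hγ 1
  have hβ_red := ih β hβ α s hαβ (hs.restrict_right hβ.le)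
  exact (hs.restrict_left hαβ).guarded_limitRed hβ hst (hp.trans hβ_red) hq

theorem Converges.redStd (hαγ : α ≤ γ) (hs : Converges α γ s) : RedStd (s α) (s γ) := by
  induction γ using WellFoundedLT.induction generalizing α s with
  | ind γ ih =>
    rcases hαγ.eq_or_lt with rfl | hαγ
    · exact .refl _
    rcases Ordinal.zero_or_succ_or_isSuccLimit γ with rfl | ⟨δ, rfl⟩ | hγ
    · exact absurd hαγ not_lt_zero
    · have hδ : δ < Order.succ δ := Order.lt_succ δ
      have hαδ : α ≤ δ := Order.le_of_lt_succ hαγ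
      have hred := ih δ hδ hαδ (hs.restrict_right hδ.le)
      rcases hs.step δ hαδ hδ with heq | ⟨d, -, hd⟩
      · exact heq ▸ hred
      · exact hred.tail (.single ⟨d, hd⟩)
    · exact LimitRed.redStd hγ (fun β hβ _ _ h₁ h₂ => ih β hβ h₁ h₂)
        ⟨α, hαγ, s, hs, .refl _, rfl⟩

end

theorem RedInf.redStd {s t : Term a b c} (h : RedInf s t) : RedStd s t := by
  obtain ⟨γ, r, d, h, rfl, rfl⟩ := h
  exact h.converges.redStd zero_le

/-! ### Concatenation of finite sequences -/

open Filter

section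

variable {X : Type*}

theorem exists_path_of_reflTransGen {R : X → X → Prop} {x y : X} (h : Relation.ReflTransGen R x y) :
    ∃ (k : ℕ) (p : ℕ → X), p 0 = x ∧ p k = y ∧ ∀ i < k, R (p i) (p (i + 1)) := by
  induction h using Relation.ReflTransGen.head_induction_on with
  | refl => exact ⟨0, fun _ => y, rfl, rfl, fun i hi => absurd hi i.not_lt_zero⟩
  | @head x z hxz _ ih =>
    obtain ⟨k, p, rfl, rfl, hp⟩ := ih
    refine ⟨k + 1, fun i => i.casesOn x p, rfl, rfl, ?_⟩
    rintro (_ | i) hi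
    · exact hxz
    · exact hp i (Nat.lt_of_succ_lt_succ hi)

theorem reflTransGen_of_path {R : X → X → Prop} {p : ℕ → X} {k : ℕ}
    (hp : ∀ i < k, R (p i) (p (i + 1))) {i : ℕ} (hi : i ≤ k) :
    Relation.ReflTransGen R (p i) (p k) := by
  induction hi using Nat.decreasingInduction with
  | self => exact .refl
  | of_succ i hi ih => exact .head (hp i hi) ih

theorem exists_block_index {k : ℕ → ℕ} (hk : ∀ n, 0 < k n) :
    ∃ e i : ℕ → ℕ, e 0 = 0 ∧ i 0 = 0 ∧ Tendsto e atTop atTop ∧ ∀ m, i m < k (e m) ∧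
      (i m + 1 < k (e m) ∧ e (m + 1) = e m ∧ i (m + 1) = i m + 1 ∨
        i m + 1 = k (e m) ∧ e (m + 1) = e m + 1 ∧ i (m + 1) = 0) := by
  let next (x : ℕ × ℕ) : ℕ × ℕ := if x.2 + 1 < k x.1 then (x.1, x.2 + 1) else (x.1 + 1, 0)
  let q (m : ℕ) : ℕ × ℕ := next^[m] (0, 0)
  have hlt (m) : (q m).2 < k (q m).1 := by
    induction m with
    | zero => exact hk 0
    | succ m _ =>
      simp only [q, Function.iterate_succ_apply', next]
      split_ifs with hm
      exacts [hm, hk _]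
  have hstep (m) : (q m).2 + 1 < k (q m).1 ∧ (q (m + 1)).1 = (q m).1 ∧
        (q (m + 1)).2 = (q m).2 + 1 ∨
      (q m).2 + 1 = k (q m).1 ∧ (q (m + 1)).1 = (q m).1 + 1 ∧ (q (m + 1)).2 = 0 := by
    rw [show q (m + 1) = next (q m) from Function.iterate_succ_apply' next m _]
    by_cases hm : (q m).2 + 1 < k (q m).1
    · exact .inl ⟨hm, by simp [next, hm]⟩
    · exact .inr ⟨le_antisymm (hlt m) (not_lt.1 hm), by simp [next, hm]⟩
  have hsum (m) : ∑ n ∈ Finset.range (q m).1, k n + (q m).2 = m := by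
    induction m with
    | zero => rfl
    | succ m ih =>
      rcases hstep m with ⟨-, he, hi⟩ | ⟨hm, he, hi⟩
      · rw [he, hi, ← add_assoc, ih]
      · rw [he, hi, Finset.sum_range_succ, ← hm, add_zero, ← add_assoc, ih]
  refine ⟨fun m => (q m).1, fun m => (q m).2, rfl, rfl, ?_, fun m => ⟨hlt m, hstep m⟩⟩
  refine tendsto_atTop.2 fun N => eventually_atTop.2 ⟨∑ n ∈ Finset.range N, k n, fun m hm => ?_⟩
  by_contra! hN
  have hle : ∑ n ∈ Finset.range ((q m).1 + 1), k n ≤ ∑ n ∈ Finset.range N, k n :=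
    Finset.sum_le_sum_of_subset (Finset.range_mono hN)
  rw [Finset.sum_range_succ] at hle
  linarith [hlt m, hsum m]

theorem exists_seq_of_reflTransGen {R : ℕ → X → X → Prop} {f : ℕ → X}
    (h : ∀ n, Relation.ReflTransGen (R n) (f n) (f (n + 1))) (hne : ∀ n, f n ≠ f (n + 1)) :
    ∃ (g : ℕ → X) (e : ℕ → ℕ), g 0 = f 0 ∧ Tendsto e atTop atTop ∧
      ∀ m, R (e m) (g m) (g (m + 1)) ∧ Relation.ReflTransGen (R (e m)) (g m) (f (e m + 1)) := by
  choose k p hp₀ hpk hp using fun n => exists_path_of_reflTransGen (h n)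
  have hk (n) : 0 < k n := by
    refine Nat.pos_of_ne_zero fun h₀ => hne n ?_
    rw [← hp₀, ← hpk, h₀]
  obtain ⟨e, i, he₀, hi₀, he, hei⟩ := exists_block_index hk
  refine ⟨fun m => p (e m) (i m), e, by simp only [he₀, hi₀, hp₀], he, fun m => ⟨?_, ?_⟩⟩
  · have hstep := hp _ _ (hei m).1
    rcases (hei m).2 with ⟨-, he, hi⟩ | ⟨hm, he, hi⟩ <;> dsimp only
    · rwa [he, hi]
    · rwa [he, hi, hp₀, ← hpk, ← hm]
  · exact hpk _ ▸ reflTransGen_of_path (hp _) (hei m).1.le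

end

/-! ### From the standard presentation to strongly converging sequences -/

theorem BetaAt.agree {d : ℕ} {s t : Term a b c} (h : BetaAt d s t) : Term.Agree d s t := by
  induction h with
  | beta u v => exact Term.agree_zero _ _
  | lam _ ih => exact Term.agree_lam_iff.2 (by rwa [Nat.add_sub_cancel])
  | appL _ ih => exact Term.agree_app_iff.2 ⟨by rwa [Nat.add_sub_cancel], rfl⟩
  | appR _ ih => exact Term.agree_app_iff.2 ⟨rfl, by rwa [Nat.add_sub_cancel]⟩

/-- `StepsFrom N s t`: a finite β-reduction sequence from `s` to `t`, all of whose steps are at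
depth at least `N`. -/
def StepsFrom (N : ℕ) : Term a b c → Term a b c → Prop := Relation.ReflTransGen (StepFrom N)

namespace StepsFrom

variable {N : ℕ} {s t u u' v v' : Term a b c}

theorem zero_iff : StepsFrom 0 s t ↔ BetaStar s t := by
  have : (StepFrom 0 : Term a b c → Term a b c → Prop) = Beta := by
    funext s t
    simp only [StepFrom, Nat.zero_le, true_and, Beta]
  rw [StepsFrom, this, BetaStar]

theorem mono {M : ℕ} (h : M ≤ N) (hst : StepsFrom N s t) : StepsFrom M s t :=
  Relation.ReflTransGen.mono (fun _ _ => StepFrom.mono h) _ _ hst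

theorem agree (h : StepsFrom N s t) : Term.Agree N s t := by
  induction h with
  | refl => exact rfl
  | tail _ h ih =>
    obtain ⟨d, hd, h⟩ := h
    exact ih.trans (h.agree.mono hd)

theorem lam (h : StepsFrom (N - a.toNat) u u') : StepsFrom N (Term.lam u) (Term.lam u') :=
  Relation.ReflTransGen.lift Term.lam (fun _ _ ⟨_, hd, h⟩ => ⟨_, by lia, h.lam⟩) _ _ h

theorem app (hu : StepsFrom (N - b.toNat) u u') (hv : StepsFrom (N - c.toNat) v v') :
    StepsFrom N (Term.app u v) (Term.app u' v') :=
  .trans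
    (Relation.ReflTransGen.lift (Term.app · v) (fun _ _ ⟨_, hd, h⟩ => ⟨_, by lia, h.appL⟩) _ _ hu)
    (Relation.ReflTransGen.lift (Term.app u') (fun _ _ ⟨_, hd, h⟩ => ⟨_, by lia, h.appR⟩) _ _ hv)

end StepsFrom

/-- `RedFrom d s t`: `t` is obtained from `s` by infinitary reductions of subterms at depth `d`. -/
inductive RedFrom : ℕ → Term a b c → Term a b c → Prop
  | zero {s t : Term a b c} : RedStd s t → RedFrom 0 s t
  | var (d n : ℕ) : RedFrom (d + 1) (Term.var n) (Term.var n)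
  | lam {d : ℕ} {u u' : Term a b c} : RedFrom (d + 1 - a.toNat) u u' →
      RedFrom (d + 1) (Term.lam u) (Term.lam u')
  | app {d : ℕ} {u u' v v' : Term a b c} : RedFrom (d + 1 - b.toNat) u u' →
      RedFrom (d + 1 - c.toNat) v v' → RedFrom (d + 1) (Term.app u v) (Term.app u' v')

theorem RedFrom.agree {d : ℕ} {s t : Term a b c} (h : RedFrom d s t) : Term.Agree d s t := by
  induction h with
  | zero => exact Term.agree_zero _ _
  | var => exact rfl
  | lam _ ih => exact Term.agree_lam_iff.2 ih
  | app _ _ ihu ihv => exact Term.agree_app_iff.2 ⟨ihu, ihv⟩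

theorem RedFrom.redStd {d : ℕ} {s t : Term a b c} (h : RedFrom d s t) : RedStd s t := by
  induction h with
  | zero h => exact h
  | var => exact .refl _
  | lam _ ih => exact RedStd.lam_iff.2 ⟨_, .refl, ih⟩
  | app _ _ ihu ihv => exact RedStd.app_iff.2 ⟨_, _, .refl, ihu, ihv⟩

theorem RedFrom.mono {d e : ℕ} {s t : Term a b c} (h : RedFrom e s t) (hde : d ≤ e) :
    RedFrom d s t := by
  induction h generalizing d with
  | zero h =>
    rw [Nat.le_zero.1 hde]
    exact .zero h
  | var e n =>
    cases d with
    | zero => exact .zero (.refl _)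
    | succ d => exact .var d n
  | lam hu ih =>
    cases d with
    | zero => exact .zero (redStd (.lam hu))
    | succ d => exact .lam (ih (by lia))
  | app hu hv ihu ihv =>
    cases d with
    | zero => exact .zero (redStd (.app hu hv))
    | succ d => exact .app (ihu (by lia)) (ihv (by lia))

theorem RedStd.exists_redFrom_one {s t : Term a b c} (h : RedStd s t) :
    ∃ s', BetaStar s s' ∧ RedFrom 1 s' t := by
  have guard (e : Bool) {u u' : Term a b c} (hu : RedStd u u')
      (ih : e = false → ∃ w, BetaStar u w ∧ RedFrom 1 w u') :
      ∃ w, StepsFrom (0 - e.toNat) u w ∧ RedFrom (0 + 1 - e.toNat) w u' := by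
    rw [Nat.zero_sub]
    simp only [StepsFrom.zero_iff]
    cases e
    · exact ih rfl
    · exact ⟨u, .refl, .zero hu⟩
  induction h using RedStd.induction with
  | var s n hs => exact ⟨_, hs, .var 0 n⟩
  | lam s u u' hs hu ih =>
    obtain ⟨w, hw, hw'⟩ := guard a hu ih
    exact ⟨_, hs.trans (StepsFrom.zero_iff.1 hw.lam), .lam hw'⟩
  | app s u u' v v' hs hu hv ihu ihv =>
    obtain ⟨w, hw, hw'⟩ := guard b hu ihu
    obtain ⟨z, hz, hz'⟩ := guard c hv ihv
    exact ⟨_, hs.trans (StepsFrom.zero_iff.1 (hw.app hz)), .app hw' hz'⟩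

theorem RedFrom.exists_succ {d : ℕ} {s t : Term a b c} (h : RedFrom d s t) :
    ∃ s', StepsFrom d s s' ∧ RedFrom (d + 1) s' t := by
  have succ_sub (e : Bool) (d : ℕ) : d + 1 - e.toNat + 1 = d + 1 + 1 - e.toNat := by
    have := e.toNat_le
    lia
  induction h with
  | zero h =>
    simp only [StepsFrom.zero_iff]
    exact h.exists_redFrom_one
  | var d n => exact ⟨_, .refl, .var _ n⟩
  | lam _ ih =>
    obtain ⟨u, hu, hu'⟩ := ih
    exact ⟨_, hu.lam, .lam (succ_sub _ _ ▸ hu')⟩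
  | app _ _ ihu ihv =>
    obtain ⟨u, hu, hu'⟩ := ihu
    obtain ⟨v, hv, hv'⟩ := ihv
    exact ⟨_, hu.app hv, .app (succ_sub _ _ ▸ hu') (succ_sub _ _ ▸ hv')⟩

theorem RedFrom.exists_add {d : ℕ} {s t : Term a b c} (h : RedFrom d s t) (k : ℕ) :
    ∃ s', StepsFrom d s s' ∧ RedFrom (d + k) s' t := by
  induction k with
  | zero => exact ⟨s, .refl, h⟩
  | succ k ih =>
    obtain ⟨r, hr, hr'⟩ := ih
    obtain ⟨s', hs, hs'⟩ := hr'.exists_succ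
    exact ⟨s', hr.trans (hs.mono (Nat.le_add_right d k)), hs'⟩

theorem RedFrom.exists_ne {d : ℕ} {s t : Term a b c} (h : RedFrom d s t) (hne : s ≠ t) :
    ∃ s', StepsFrom d s s' ∧ RedFrom (d + 1) s' t ∧ s ≠ s' := by
  obtain ⟨e, he⟩ : ∃ e, ¬ Term.Agree e s t := by
    by_contra! hall
    exact hne (Term.eq_of_forall_agree hall)
  obtain ⟨s', hs, hs'⟩ := h.exists_add (e + 1)
  refine ⟨s', hs, hs'.mono (by lia), ?_⟩
  rintro rfl
  exact he (hs'.agree.mono (by lia))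

theorem BetaStar.redInf {s t : Term a b c} (h : BetaStar s t) : RedInf s t := by
  obtain ⟨k, p, rfl, rfl, hp⟩ := exists_path_of_reflTransGen h
  choose! d hd using hp
  have no_limit (γ : Ordinal.{0}) (hγ : γ ≤ k) : ¬ Order.IsSuccLimit γ := fun h =>
    ((Ordinal.omega0_le_of_isSuccLimit h).trans hγ).not_gt (Ordinal.natCast_lt_omega0 k)
  refine ⟨k, fun δ => p (Cardinal.toNat δ.card), fun δ => d (Cardinal.toNat δ.card),
    ⟨fun δ hδ => ?_, fun γ hγ h => absurd h (no_limit γ hγ),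
      fun γ hγ h => absurd h (no_limit γ hγ)⟩, by simp, by simp⟩
  obtain ⟨n, rfl⟩ := Ordinal.lt_omega0.1 (hδ.trans (Ordinal.natCast_lt_omega0 k))
  simpa using hd n (Nat.cast_lt.1 hδ)

theorem redInf_of_nat_seq {f : ℕ → Term a b c} {d : ℕ → ℕ} {t : Term a b c}
    (hstep : ∀ n, BetaAt (d n) (f n) (f (n + 1))) (hd : Tendsto d atTop atTop)
    (hlim : ∀ N, ∀ᶠ n in atTop, Term.Agree N (f n) t) : RedInf (f 0) t := by
  let r (δ : Ordinal.{0}) : Term a b c :=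
    if δ < Ordinal.omega0 then f (Cardinal.toNat δ.card) else t
  have hr (n : ℕ) : r n = f n := by simp [r, Ordinal.natCast_lt_omega0]
  have hrω : r Ordinal.omega0 = t := if_neg (lt_irrefl _)
  have eq_omega0 {γ : Ordinal.{0}} (hγ : γ ≤ Ordinal.omega0) (h : Order.IsSuccLimit γ) :
      γ = Ordinal.omega0 := hγ.antisymm (Ordinal.omega0_le_of_isSuccLimit h)
  refine ⟨Ordinal.omega0, r, fun δ => d (Cardinal.toNat δ.card),
    ⟨fun δ hδ => ?_, fun γ hγ h ε hε => ?_, fun γ hγ h N => ?_⟩, by simpa using hr 0, hrω⟩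
  · obtain ⟨n, rfl⟩ := Ordinal.lt_omega0.1 hδ
    rw [hr, ← Nat.cast_succ, hr]
    simpa using hstep n
  · obtain rfl := eq_omega0 hγ h
    obtain ⟨N, hN⟩ := exists_pow_lt_of_lt_one hε (by norm_num : (1 / 2 : ℝ) < 1)
    obtain ⟨n₀, hn₀⟩ := eventually_atTop.1 (hlim N)
    refine ⟨n₀, Ordinal.natCast_lt_omega0 n₀, fun δ h₁ h₂ => ?_⟩
    obtain ⟨n, rfl⟩ := Ordinal.lt_omega0.1 h₂
    rw [hr, hrω]
    exact (hn₀ n (Nat.cast_le.1 h₁)).dist_le.trans_lt hN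
  · obtain rfl := eq_omega0 hγ h
    obtain ⟨n₀, hn₀⟩ := eventually_atTop.1 (tendsto_atTop.1 hd N)
    refine ⟨n₀, Ordinal.natCast_lt_omega0 n₀, fun δ h₁ h₂ => ?_⟩
    obtain ⟨n, rfl⟩ := Ordinal.lt_omega0.1 h₂
    simpa using hn₀ n (Nat.cast_le.1 h₁)

theorem RedStd.exists_stepsFrom_seq {s t : Term a b c} (h : RedStd s t) (hst : ¬ BetaStar s t) :
    ∃ f : ℕ → Term a b c, f 0 = s ∧
      ∀ n, StepsFrom n (f n) (f (n + 1)) ∧ f n ≠ f (n + 1) ∧ RedFrom n (f n) t := by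
  have next (n : ℕ) (r : Term a b c) (hr : BetaStar s r ∧ RedFrom n r t) :
      ∃ r', (BetaStar s r' ∧ RedFrom (n + 1) r' t) ∧ StepsFrom n r r' ∧ r ≠ r' := by
    obtain ⟨r', hrr', hr', hne⟩ := hr.2.exists_ne (by rintro rfl; exact hst hr.1)
    exact ⟨r', ⟨hr.1.trans (StepsFrom.zero_iff.1 (hrr'.mono n.zero_le)), hr'⟩, hrr', hne⟩
  have : Nonempty (Term a b c) := ⟨s⟩
  choose! F hF hstep hne using next
  let f (n : ℕ) : Term a b c := n.rec s F
  have hf (n : ℕ) : BetaStar s (f n) ∧ RedFrom n (f n) t := by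
    induction n with
    | zero => exact ⟨.refl, .zero h⟩
    | succ n ih => exact hF n _ ih
  exact ⟨f, rfl, fun n => ⟨hstep n _ (hf n), hne n _ (hf n), (hf n).2⟩⟩

theorem RedStd.redInf {s t : Term a b c} (h : RedStd s t) : RedInf s t := by
  by_cases hst : BetaStar s t
  · exact hst.redInf
  obtain ⟨f, rfl, hf⟩ := h.exists_stepsFrom_seq hst
  obtain ⟨g, e, hg₀, he, hg⟩ :=
    exists_seq_of_reflTransGen (fun n => (hf n).1) fun n => (hf n).2.1
  choose d hed hd using fun m => (hg m).1
  rw [← hg₀]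
  refine redInf_of_nat_seq hd (tendsto_atTop_mono hed he) fun N => ?_
  filter_upwards [tendsto_atTop.1 he N] with m hm
  have hsteps : Term.Agree (e m) (g m) (f (e m + 1)) := StepsFrom.agree (hg m).2
  have hlim : Term.Agree (e m + 1) (f (e m + 1)) t := (hf (e m + 1)).2.2.agree
  exact Term.Agree.mono hm (hsteps.trans (hlim.mono (e m).le_succ))

theorem redInf_iff_redStd {s t : Term a b c} : RedInf s t ↔ RedStd s t :=
  ⟨RedInf.redStd, RedStd.redInf⟩

end InfLam

theorem mainTheorem5_general (a b c : Bool) :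
    (∀ (γ : Ordinal.{0}) (s t t' : InfLam.Term a b c),
      InfLam.RedI γ s t → InfLam.Beta t t' → InfLam.RedI γ s t') ∧
    (∀ (γ : Ordinal.{0}) (s t : InfLam.Term a b c), InfLam.RedInf s t ↔ InfLam.RedI γ s t) ∧
    (∀ (γ : Ordinal.{0}) (s t : InfLam.Term a b c), InfLam.RedI γ s t ↔ InfLam.RedStd s t) :=
  ⟨fun _ _ _ _ => InfLam.RedI.tail,
    fun _ _ _ => InfLam.redInf_iff_redStd.trans InfLam.redI_iff_redStd.symm,
    fun _ _ _ => InfLam.redI_iff_redStd⟩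

theorem mainTheorem5 (a b c : Bool) :
    InfLam.PropertyQ a b c ∧
    InfLam.HasCompression a b c ∧
    (∀ s t : InfLam.Term a b c, InfLam.RedCoind s t ↔ InfLam.RedStd s t) ∧
    (∀ s t : InfLam.Term a b c, InfLam.RedInf s t ↔ InfLam.RedStd s t) := by
  obtain ⟨tail, redInf_iff, redI_iff⟩ := mainTheorem5_general a b c
  exact ⟨fun δ s t t' _ h ht => ⟨s, .refl, tail δ s t t' h ht⟩, redInf_iff 0,
    fun s t => ⟨fun ⟨γ, _, h⟩ => (redI_iff γ s t).1 h,
      fun h => ⟨0, Ordinal.omega_pos 1, (redI_iff 0 s t).2 h⟩⟩,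
    fun s t => (redInf_iff 0 s t).trans (redI_iff 0 s t)⟩
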